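/- **Setting.** Let $a>0$, $b<0$, $\epsilon>0$, $0<T<\infty$, $\gamma\ge 0$ and $\beta\in\mathbb R$ be constants. Put $D=\,]a,\infty[$, $B=[b-\epsilon,b]$ and $\mathrm{dist}(D,B)=\inf\{|x-y|: x\in D,\ y\in B\}$. Let $f\in L^2(\mathbb R)$ be real valued with $\mathrm{supp}\,f\subset B$, and assume that for some $\mu\in\mathbb R$ $$\liminf_{\tau\to\infty}\ \tau^{\mu}\left|\int_{b-\epsilon}^{b}e^{-\tau(b-y)}f(y)\,dy\right|>0 .$$ Let $u=u(x,t)$ be the weak solution of $$\partial_t^2u-\partial_x^2u=0\ \text{ in }\ ]-\infty,a[\,\times\,]0,T[,\qquad u(x,0)=0,\quad \partial_tu(x,0)=f(x)\ \text{ in }\ ]-\infty,a[,$$ $$-\partial_xu(a,t)-\gamma\,\partial_tu(a,t)-\beta\,u(a,t)=0,\qquad 0<t<T,$$ that is, with $V=H^1(]-\infty,a[)$, $H=L^2(]-\infty,a[)$ and $(\cdot,\cdot)$ the inner product of $H$: $u\in L^2(0,T;V)$, $u'\in L^2(0,T;H)$, $u(0)=0$, and for every $\varphi\in V$ $$\frac{d}{dt}\Big[(u'(t),\varphi)+\gamma\,u(a,t)\varphi(a)\Big]+\int_{-\infty}^a\partial_xu(x,t)\,\varphi'(x)\,dx+\beta\,u(a,t)\varphi(a)=0$$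 on $]0,T[$ in the sense of distributions, where the bracket has the initial value $(f,\varphi)$ at $t=0$. For $\tau>0$ set $$w(x,\tau)=\int_0^Te^{-\tau t}u(x,t)\,dt\quad(x<a),\qquad v(x,\tau)=\frac1{2\tau}\int_{-\infty}^{\infty}e^{-\tau|x-y|}f(y)\,dy\quad(x\in\mathbb R).$$ **Theorem 4.2.** Assume $T>2\,\mathrm{dist}(D,B)$. (i) Let $\gamma\ne1$. If $\gamma<1$, there is $\tau_0>0$ such that $\int_Bf(w-v)\,dy>0$ for all $\tau\ge\tau_0$. If $\gamma>1$, there is $\tau_0>0$ such that $\int_Bf(w-v)\,dy<0$ for all $\tau\ge\tau_0$. In both cases $$\lim_{\tau\to\infty}\frac1{2\tau}\log\left|\int_Bf(w-v)\,dy\right|=-\mathrm{dist}(D,B).\tag{$*$}$$ (ii) Let $\gamma=1$ and $\beta\ne0$. If $\beta<0$, there is $\tau_0>0$ such that $\int_Bf(w-v)\,dy>0$ for all $\tau\ge\tau_0$. If $\beta>0$, there is $\tau_0>0$ such that $\int_Bf(w-v)\,dy<0$ for all $\tau\ge\tau_0$. In both cases $(*)$ holds. -/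

import Mathlib

open MeasureTheory Set Filter Topology
open scoped ContDiff

namespace BackScattering

/-- The distance between two sets of real numbers,
`dist (A, B) = inf { |x - y| : x ∈ A, y ∈ B }`. -/
noncomputable def setDist (A B : Set ℝ) : ℝ := sInf (Set.image2 dist A B)

/-- Smooth compactly supported functions on the line whose support lies in `s`. -/
def IsTestOn (s : Set ℝ) (θ : ℝ → ℝ) : Prop :=
  ContDiff ℝ ∞ θ ∧ HasCompactSupport θ ∧ tsupport θ ⊆ s

/-- `φ` belongs to the Sobolev space `H¹(]-∞, a[)`, its weak derivative is `φ'` and its trace at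
the end point `a` is `c`.

Restricted to test functions supported in `]-∞, a[`, the last field says that `φ'` is the weak
derivative of `φ`; on test functions of the whole line it is Green's formula, which determines the
trace (the value at `a` of the continuous representative). Every element of `H¹(]-∞, a[)` has
exactly one weak derivative (a.e.) and exactly one trace. -/
structure MemH1 (a : ℝ) (φ φ' : ℝ → ℝ) (c : ℝ) : Prop where
  memLp : MemLp φ 2 (volume.restrict (Iio a))
  memLp_deriv : MemLp φ' 2 (volume.restrict (Iio a))
  green : ∀ ζ : ℝ → ℝ, IsTestOn univ ζ →
    ∫ x in Iio a, φ x * deriv ζ x = c * ζ a - ∫ x in Iio a, φ' x * ζ x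

/-- `u = u(x, t)` is a weak (finite energy) solution of
`∂ₜ²u - ∂ₓ²u = 0` in `]-∞, a[ × ]0, T[`, `u(·, 0) = 0`, `∂ₜu(·, 0) = f`,
`-∂ₓu(a, t) - γ ∂ₜu(a, t) - β u(a, t) = 0` for `0 < t < T`.

With `V = H¹(]-∞, a[)` and `H = L²(]-∞, a[)` this means: `u ∈ L²(0, T; V)`, `u' ∈ L²(0, T; H)`,
`u(0) = 0`, and for every `φ ∈ V`
`d/dt { (u'(t), φ) + γ u(a, t) φ(a) } + ∫ ∂ₓu(x, t) φ'(x) dx + β u(a, t) φ(a) = 0`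
on `]0, T[` in the sense of distributions, the expression in braces having the initial
value `(f, φ)`. The two initial conditions are built into the weak formulations in time through
test functions which need not vanish at `t = 0`.
Here `ux`, `ut` are the weak derivatives and `h(t)` is the trace `u(a, t)`. -/
def IsWeakSolution (a T γ β : ℝ) (f : ℝ → ℝ) (u : ℝ → ℝ → ℝ) : Prop :=
  ∃ (ux ut : ℝ → ℝ → ℝ) (h : ℝ → ℝ),
    -- `u ∈ L²(0, T; V)`
    MemLp (Function.uncurry u) 2 (volume.restrict (Iio a ×ˢ Ioo 0 T)) ∧
    MemLp (Function.uncurry ux) 2 (volume.restrict (Iio a ×ˢ Ioo 0 T)) ∧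
    MemLp h 2 (volume.restrict (Ioo 0 T)) ∧
    (∀ᵐ t ∂(volume.restrict (Ioo 0 T)), MemH1 a (fun x => u x t) (fun x => ux x t) (h t)) ∧
    -- `u' ∈ L²(0, T; H)` and `u(0) = 0`
    MemLp (Function.uncurry ut) 2 (volume.restrict (Iio a ×ˢ Ioo 0 T)) ∧
    (∀ θ : ℝ → ℝ, IsTestOn (Iio T) θ → ∀ᵐ x ∂(volume.restrict (Iio a)),
      ∫ t in Ioo 0 T, u x t * deriv θ t = -∫ t in Ioo 0 T, ut x t * θ t) ∧
    -- the variational equation and `u'(0) = f`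
    (∀ (φ φ' : ℝ → ℝ) (c : ℝ), MemH1 a φ φ' c → ∀ θ : ℝ → ℝ, IsTestOn (Iio T) θ →
      ∫ t in Ioo 0 T,
        (-((∫ x in Iio a, ut x t * φ x) + γ * h t * c) * deriv θ t +
          ((∫ x in Iio a, ux x t * φ' x) + β * h t * c) * θ t) =
      (∫ x in Iio a, f x * φ x) * θ 0)

/-- `w(x, τ) = ∫₀ᵀ e^{-τ t} u(x, t) dt`. -/
noncomputable def wTransform (T : ℝ) (u : ℝ → ℝ → ℝ) (x τ : ℝ) : ℝ :=
  ∫ t in Ioo 0 T, Real.exp (-τ * t) * u x t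

/-- `v(x, τ) = (1 / 2τ) ∫ e^{-τ |x - y|} f(y) dy`. -/
noncomputable def vPotential (f : ℝ → ℝ) (x τ : ℝ) : ℝ :=
  1 / (2 * τ) * ∫ y, Real.exp (-τ * |x - y|) * f y

/-- The back-scattering data `∫_B f(y) (w(y, τ) - v(y, τ)) dy`. -/
noncomputable def backScatteringData (B : Set ℝ) (T : ℝ) (f : ℝ → ℝ) (u : ℝ → ℝ → ℝ)
    (τ : ℝ) : ℝ :=
  ∫ y in B, f y * (wTransform T u y τ - vPotential f y τ)

end BackScattering

/-! Let `G` solve G'' = τ²G − f on x < a with G'(a) + (γτ + β)G(a) = 0, and test the weak equation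
with G(x)θ(t). For θ = e^{-τt} the interior and boundary terms would cancel, leaving the pairings of
f with w and with G, plus terms at t = T. Taking θ = e^{-τt}χ(t) instead, with χ = 1 for 0 ≤ t < S
and χ supported in t < T, avoids traces at T: every error lives on t ≥ S and is O(τe^{-τS})
(`IsWeakSolution.integral_identity`, `exists_abs_backScatteringData_sub_le`).

Here G is explicit: v plus a reflected wave Ce^{τ(x-a)}. As f lives to the left of a, v(a) = L/(2τ)
and v'(a) = −L/2 with L = `leftPart f τ a`. The boundary condition forces C = (L/2τ)R with R = (τ −
γτ − β)/(τ + γτ + β), and ∫f(G − v) = L²R/(2τ).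

Finally L = e^{-τ(a-b)}F(τ), where F is the integral assumed not to decay faster than every power.
The main term e^{-2τ(a-b)}F²R/(2τ) has the sign of (1 − γ)τ − β and equals e^{-2τ(a-b)} up to powers
of τ. Any S with 2(a − b) < S < T makes the error negligible against it
(`sign_and_tendsto_backScatteringData`).

Since f is only L², G'' exists only almost everywhere; derivatives are therefore handled through
primitives, and elements of H¹ are identified with primitives by `MemH1.exists_primitive`. -/

namespace BackScattering

/-! ### Primitives and integration by parts -/

/-- `P` is a primitive of the locally integrable function `k` on the set `s`. -/
def IsPrimitiveOn (P k : ℝ → ℝ) (s : Set ℝ) : Prop :=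
  ∀ x ∈ s, ∀ y ∈ s, IntervalIntegrable k volume x y ∧ ∫ t in x..y, k t = P y - P x

namespace IsPrimitiveOn

variable {P Q k l : ℝ → ℝ} {s : Set ℝ}

lemma mono {t : Set ℝ} (h : IsPrimitiveOn P k s) (hts : t ⊆ s) : IsPrimitiveOn P k t :=
  fun x hx y hy => h x (hts hx) y (hts hy)

lemma add (hP : IsPrimitiveOn P k s) (hQ : IsPrimitiveOn Q l s) :
    IsPrimitiveOn (fun x => P x + Q x) (fun x => k x + l x) s := fun x hx y hy => by
  obtain ⟨h1, h2⟩ := hP x hx y hy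
  obtain ⟨h3, h4⟩ := hQ x hx y hy
  exact ⟨h1.add h3, by rw [intervalIntegral.integral_add h1 h3, h2, h4]; ring⟩

lemma const_mul (c : ℝ) (hP : IsPrimitiveOn P k s) :
    IsPrimitiveOn (fun x => c * P x) (fun x => c * k x) s := fun x hx y hy => by
  obtain ⟨h1, h2⟩ := hP x hx y hy
  exact ⟨h1.const_mul c, by rw [intervalIntegral.integral_const_mul, h2]; ring⟩

lemma congr_deriv (hP : IsPrimitiveOn P k s) (h : ∀ x, k x = l x) : IsPrimitiveOn P l s := by
  rwa [show l = k from funext fun x => (h x).symm]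

lemma of_hasDerivAt (h : ∀ x, HasDerivAt P (k x) x) (hk : Continuous k) :
    IsPrimitiveOn P k s := fun _ _ _ _ =>
  ⟨hk.intervalIntegrable _ _, intervalIntegral.integral_eq_sub_of_hasDerivAt (fun x _ => h x)
    (hk.intervalIntegrable _ _)⟩

lemma of_integral {c : ℝ} {a : ℝ} (hk : ∀ x ∈ s, ∀ y ∈ s, IntervalIntegrable k volume x y)
    (ha : a ∈ s) : IsPrimitiveOn (fun x => c + ∫ t in a..x, k t) k s := fun x hx y hy => by
  refine ⟨hk x hx y hy, ?_⟩
  rw [add_sub_add_left_eq_sub,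
    intervalIntegral.integral_interval_sub_left (hk a ha y hy) (hk a ha x hx)]

/-- Links primitives to the theory of absolutely continuous functions, which supplies continuity and
the product rule below. -/
lemma exists_absolutelyContinuous (hP : IsPrimitiveOn P k s) {x y : ℝ} (hxy : uIcc x y ⊆ s) :
    ∃ R : ℝ → ℝ, AbsolutelyContinuousOnInterval R x y ∧ (∀ z ∈ uIcc x y, R z = P z) ∧
      ∀ᵐ z, z ∈ uIcc x y → deriv R z = k z := by
  have hx := hxy left_mem_uIcc
  have hi := (hP x hx y (hxy right_mem_uIcc)).1
  refine ⟨fun z => P x + ∫ t in x..z, k t, ?_, fun z hz => ?_, ?_⟩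
  · have hc : AbsolutelyContinuousOnInterval (fun _ : ℝ => P x) x y :=
      (contDiff_const.contDiffOn).absolutelyContinuousOnInterval
    exact hc.add (hi.absolutelyContinuousOnInterval_intervalIntegral left_mem_uIcc)
  · simp only [(hP x hx z (hxy hz)).2]; ring
  · filter_upwards [hi.ae_hasDerivAt_integral] with z hz hz'
    exact ((hz hz' x left_mem_uIcc).const_add (P x)).deriv

lemma continuousOn (hP : IsPrimitiveOn P k s) {x y : ℝ} (hxy : uIcc x y ⊆ s) :
    ContinuousOn P (uIcc x y) := by
  obtain ⟨R, hR, hRP, -⟩ := hP.exists_absolutelyContinuous hxy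
  exact hR.continuousOn.congr fun z hz => (hRP z hz).symm

lemma mul [s.OrdConnected] (hP : IsPrimitiveOn P k s) (hQ : IsPrimitiveOn Q l s) :
    IsPrimitiveOn (fun x => P x * Q x) (fun x => k x * Q x + P x * l x) s := fun x hx y hy => by
  have hxy : uIcc x y ⊆ s := OrdConnected.uIcc_subset ‹_› hx hy
  refine ⟨((hP x hx y hy).1.mul_continuousOn (hQ.continuousOn hxy)).add
    ((hQ x hx y hy).1.continuousOn_mul (hP.continuousOn hxy)), ?_⟩
  obtain ⟨R, hR, hRP, hRd⟩ := hP.exists_absolutelyContinuous hxy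
  obtain ⟨S, hS, hSQ, hSd⟩ := hQ.exists_absolutelyContinuous hxy
  simp only
  rw [← hRP x left_mem_uIcc, ← hRP y right_mem_uIcc, ← hSQ x left_mem_uIcc,
    ← hSQ y right_mem_uIcc, ← hR.integral_deriv_mul_eq_sub hS]
  apply intervalIntegral.integral_congr_ae
  filter_upwards [hRd, hSd] with z h1 h2 h3
  have hz := uIoc_subset_uIcc h3
  rw [h1 hz, h2 hz, hRP z hz, hSQ z hz]

/-- A primitive on `]-∞, a]` which vanishes near `-∞` is recovered by integration from `-∞`. -/
lemma integral_Iio_eq_of_eventually {a : ℝ} (hP : IsPrimitiveOn P k (Iic a))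
    (hk : IntegrableOn k (Iio a)) (h0 : ∀ᶠ x in atBot, P x = 0) :
    ∫ x in Iio a, k x = P a := by
  rw [← integral_Iic_eq_integral_Iio]
  have h1 := intervalIntegral_tendsto_integral_Iic (μ := volume) (f := k) a
    ((integrableOn_Iic_iff_integrableOn_Iio (by simp)).2 hk) tendsto_id
  refine tendsto_nhds_unique h1 (tendsto_const_nhds.congr' ?_)
  filter_upwards [h0, eventually_le_atBot a] with x hx hxa
  rw [id, (hP x hxa a (mem_Iic.2 le_rfl)).2, hx, sub_zero]

/-- An integrable primitive of an integrable function on `]-∞, a]` vanishes at `-∞`. -/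
lemma integral_Iio_eq {a : ℝ} (hP : IsPrimitiveOn P k (Iic a))
    (hk : IntegrableOn k (Iio a)) (hPi : IntegrableOn P (Iio a)) :
    ∫ x in Iio a, k x = P a := by
  rw [← integral_Iic_eq_integral_Iio]
  have h1 := intervalIntegral_tendsto_integral_Iic (μ := volume) (f := k) a
    ((integrableOn_Iic_iff_integrableOn_Iio (by simp)).2 hk) tendsto_id
  have h2 : Tendsto P atBot (𝓝 (P a - ∫ x in Iic a, k x)) := by
    refine (tendsto_const_nhds (x := P a).sub h1).congr' ?_
    filter_upwards [eventually_le_atBot a] with x hxa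
    rw [id, (hP x hxa a (mem_Iic.2 le_rfl)).2]; ring
  -- The limit at −∞ exists because `k` is integrable; a nonzero limit would contradict
  -- integrability of `P`, as neighbourhoods of −∞ have infinite measure.
  have h3 : IntegrableAtFilter P atBot volume := ⟨Iio a, Iio_mem_atBot a, hPi⟩
  have := h3.eq_zero_of_tendsto (fun s hs => ?_) h2
  · linarith
  · obtain ⟨b, hb⟩ := mem_atBot_sets.1 hs
    exact top_unique (by rw [← Real.volume_Iic (a := b)]; exact measure_mono hb)

end IsPrimitiveOn

/-! ### The space H¹ on a half-line -/

lemma _root_.MeasureTheory.MemLp.intervalIntegrable_of_Iio {a : ℝ} {k : ℝ → ℝ}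
    (hk : MemLp k 2 (volume.restrict (Iio a))) :
    ∀ x ∈ Iic a, ∀ y ∈ Iic a, IntervalIntegrable k volume x y := fun x hx y hy => by
  rw [intervalIntegrable_iff]
  rw [Measure.restrict_congr_set Iio_ae_eq_Iic] at hk
  have h : uIoc x y ⊆ Iic a := fun z hz => hz.2.trans (max_le hx hy)
  have h2 := hk.mono_measure (Measure.restrict_mono h le_rfl)
  have : IsFiniteMeasure (volume.restrict (uIoc x y)) :=
    isFiniteMeasure_restrict.2 (by simp [uIoc])
  exact h2.integrable (by norm_num)

lemma IsPrimitiveOn.locallyIntegrable {a : ℝ} {P k : ℝ → ℝ} (hP : IsPrimitiveOn P k (Iic a)) :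
    LocallyIntegrable P (volume.restrict (Iio a)) := by
  have hc : ContinuousOn P (Iic a) := fun z hz => by
    have hza : z - 1 ≤ a := by linarith [mem_Iic.1 hz]
    have h1 : uIcc (z - 1) a ⊆ Iic a := by rw [uIcc_of_le hza]; exact Icc_subset_Iic_self
    refine (hP.continuousOn h1 z ?_).mono_of_mem_nhdsWithin ?_
    · rw [uIcc_of_le hza]; exact ⟨by linarith, hz⟩
    · rw [uIcc_of_le hza, ← Ici_inter_Iic, inter_comm]
      exact inter_mem_nhdsWithin _ (Ici_mem_nhds (by linarith))
  rw [Measure.restrict_congr_set Iio_ae_eq_Iic]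
  exact (locallyIntegrableOn_iff_locallyIntegrable_restrict isClosed_Iic).1
    (hc.locallyIntegrableOn measurableSet_Iic)

/-- A primitive satisfies Green's formula against test functions of the line. -/
lemma IsPrimitiveOn.green {a : ℝ} {P k ζ : ℝ → ℝ} (hP : IsPrimitiveOn P k (Iic a))
    (hk : MemLp k 2 (volume.restrict (Iio a)))
    (hζ : IsTestOn univ ζ) :
    IntegrableOn (fun x => P x * deriv ζ x) (Iio a) ∧ IntegrableOn (fun x => k x * ζ x) (Iio a) ∧
    ∫ x in Iio a, P x * deriv ζ x = P a * ζ a - ∫ x in Iio a, k x * ζ x := by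
  obtain ⟨h1, h2, -⟩ := hζ
  have hd : Continuous (deriv ζ) := h1.continuous_deriv (by simp)
  have hQ : IsPrimitiveOn ζ (deriv ζ) (Iic a) := IsPrimitiveOn.of_hasDerivAt
    (fun x => (h1.differentiable (by simp) x).hasDerivAt) hd
  have i1 : IntegrableOn (fun x => P x * deriv ζ x) (Iio a) := by
    have := hP.locallyIntegrable.integrable_smul_left_of_hasCompactSupport hd h2.deriv
    simpa only [IntegrableOn, smul_eq_mul, mul_comm] using this
  have i2 : IntegrableOn (fun x => k x * ζ x) (Iio a) := by
    have h3 : MemLp ζ 2 (volume.restrict (Iio a)) :=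
      (h1.continuous.memLp_of_hasCompactSupport h2).restrict _
    exact hk.integrable_mul h3
  refine ⟨i1, i2, ?_⟩
  rw [eq_sub_iff_add_eq', ← integral_add i2 i1]
  refine (hP.mul hQ).integral_Iio_eq_of_eventually (i2.add i1) ?_
  have := (hasCompactSupport_iff_eventuallyEq.1 h2)
  rw [coclosedCompact_eq_cocompact] at this
  filter_upwards [atBot_le_cocompact this] with x hx
  simp [hx]

lemma IsPrimitiveOn.memH1 {a : ℝ} {P k : ℝ → ℝ} (hP : IsPrimitiveOn P k (Iic a))
    (hPm : MemLp P 2 (volume.restrict (Iio a))) (hk : MemLp k 2 (volume.restrict (Iio a))) :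
    MemH1 a P k (P a) :=
  ⟨hPm, hk, fun _ hζ => (hP.green hk hζ).2.2⟩

/-- Green's formula only sees derivatives of test functions. A primitive of `η` started left of its
support need not vanish to the right, but it can be cut off beyond `a`, where nothing is tested. -/
lemma exists_isTestOn_deriv_eq {a : ℝ} {η : ℝ → ℝ} (h1 : ContDiff ℝ ∞ η)
    (h2 : HasCompactSupport η) :
    ∃ ζ : ℝ → ℝ, IsTestOn univ ζ ∧ ∀ x < a, deriv ζ x = η x := by
  obtain ⟨M, hM0, hM⟩ : ∃ M : ℝ, |a| < M ∧ ∀ x, M ≤ |x| → η x = 0 := by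
    obtain ⟨r, hr⟩ := h2.isCompact.isBounded.subset_closedBall 0
    refine ⟨max r |a| + 1, by linarith [le_max_right r |a|], fun x hx => ?_⟩
    by_contra h
    have := hr (subset_tsupport _ h)
    rw [mem_closedBall_zero_iff, Real.norm_eq_abs] at this
    linarith [le_max_left r |a|]
  have hM1 : 0 < M := (abs_nonneg a).trans_lt hM0
  set E : ℝ → ℝ := fun x => ∫ t in (-M)..x, η t
  have hE : ∀ x, HasDerivAt E (η x) x := fun x =>
    intervalIntegral.integral_hasDerivAt_right (h1.continuous.intervalIntegrable _ _)
      (h1.continuous.stronglyMeasurableAtFilter _ _) h1.continuous.continuousAt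
  have hEs : ContDiff ℝ ∞ E := contDiff_infty_iff_deriv.2
    ⟨fun x => (hE x).differentiableAt, by rwa [show deriv E = η from funext fun x => (hE x).deriv]⟩
  have hE0 : ∀ x ≤ -M, E x = 0 := fun x hx => by
    refine (intervalIntegral.integral_congr (g := fun _ => (0 : ℝ)) fun t ht => ?_).trans (by simp)
    rw [uIcc_of_ge hx] at ht
    exact hM t (by rw [abs_of_nonpos (by linarith [ht.2])]; linarith [ht.2])
  let θ : ContDiffBump (0 : ℝ) := ⟨M, M + 1, hM1, by linarith⟩
  have hθ : ContDiff ℝ ∞ (θ : ℝ → ℝ) := θ.contDiff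
  refine ⟨fun x => θ x * E x, ⟨hθ.mul hEs, θ.hasCompactSupport.mul_right, subset_univ _⟩,
    fun x hx => ?_⟩
  rcases le_or_gt x (-M) with h | h
  · rw [hM x (by rw [abs_of_nonpos (by linarith)]; linarith),
      ((hθ.differentiable (by simp) x).hasDerivAt.fun_mul (hE x)).deriv,
      hE0 x h, hM x (by rw [abs_of_nonpos (by linarith)]; linarith)]
    simp
  · have : (fun x => θ x * E x) =ᶠ[𝓝 x] E := by
      have : x ∈ Metric.ball (0 : ℝ) M := by
        rw [mem_ball_zero_iff, Real.norm_eq_abs, abs_lt]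
        exact ⟨h, hx.trans_le (le_abs_self a) |>.trans hM0⟩
      filter_upwards [Metric.isOpen_ball.mem_nhds this] with y hy
      rw [θ.one_of_mem_closedBall (Metric.ball_subset_closedBall hy), one_mul]
    rw [this.deriv_eq, (hE x).deriv]

/-- An element of `H¹(]-∞, a[)` is almost everywhere equal to a primitive of its weak derivative,
whose value at `a` is the trace. -/
lemma MemH1.exists_primitive {a c : ℝ} {φ φ' : ℝ → ℝ} (h : MemH1 a φ φ' c) :
    ∃ P : ℝ → ℝ, IsPrimitiveOn P φ' (Iic a) ∧ P a = c ∧ φ =ᵐ[volume.restrict (Iio a)] P := by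
  have hP : IsPrimitiveOn (fun x => c + ∫ t in a..x, φ' t) φ' (Iic a) :=
    IsPrimitiveOn.of_integral h.memLp_deriv.intervalIntegrable_of_Iio (mem_Iic.2 le_rfl)
  set P := fun x => c + ∫ t in a..x, φ' t
  have hPa : P a = c := by simp [P]
  refine ⟨P, hP, hPa, ?_⟩
  have hφl : LocallyIntegrable φ (volume.restrict (Iio a)) := h.memLp.locallyIntegrable (by norm_num)
  -- Every test function is a derivative `deriv ζ` on x < a, and both functions obey Green's formula
  -- with the same derivative and the same trace, so their integrals against it agree.
  have key := ae_eq_of_integral_contDiff_smul_eq hφl hP.locallyIntegrable (fun η h1 h2 => ?_)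
  · exact key
  · obtain ⟨ζ, hζ, hd⟩ := exists_isTestOn_deriv_eq (a := a) h1 h2
    have e : ∀ R : ℝ → ℝ, ∫ x in Iio a, η x • R x = ∫ x in Iio a, R x * deriv ζ x := fun R =>
      setIntegral_congr_fun measurableSet_Iio fun x hx => by
        simp only [smul_eq_mul]; rw [hd x hx, mul_comm]
    rw [e, e, h.green ζ hζ, (hP.green h.memLp_deriv hζ).2.2, hPa]

/-- Green's formula for an element of `H¹(]-∞, a[)` and a primitive. -/
lemma MemH1.integral_mul_add {a c : ℝ} {φ φ' Z g : ℝ → ℝ} (h : MemH1 a φ φ' c)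
    (hZ : IsPrimitiveOn Z g (Iic a)) (hZm : MemLp Z 2 (volume.restrict (Iio a)))
    (hg : MemLp g 2 (volume.restrict (Iio a))) :
    (∫ x in Iio a, φ' x * Z x) + ∫ x in Iio a, φ x * g x = c * Z a := by
  obtain ⟨P, hP, hPa, hφ⟩ := h.exists_primitive
  have hPm : MemLp P 2 (volume.restrict (Iio a)) := h.memLp.ae_eq hφ
  have i1 : IntegrableOn (fun x => φ' x * Z x) (Iio a) := h.memLp_deriv.integrable_mul hZm
  have i2 : IntegrableOn (fun x => P x * g x) (Iio a) := hPm.integrable_mul hg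
  have e : ∫ x in Iio a, φ x * g x = ∫ x in Iio a, P x * g x :=
    integral_congr_ae (hφ.mono fun x hx => by simp only [hx])
  rw [e, ← integral_add i1 i2, ← hPa]
  exact (hP.mul hZ).integral_Iio_eq (i1.add i2) (hPm.integrable_mul hZm)

/-! ### The potential v: equations and decay -/

lemma integrable_continuous_mul {f : ℝ → ℝ} {c d : ℝ} (hf : MemLp f 2 volume)
    (hsupp : ∀ᵐ x ∂(volume : Measure ℝ), x ∉ Icc c d → f x = 0) {k : ℝ → ℝ} (hk : Continuous k) :
    Integrable (fun y => k y * f y) := by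
  have h1 : IntegrableOn f (Icc c d) := (hf.restrict _).integrable (by norm_num)
  have h2 : IntegrableOn (fun y => k y * f y) (Icc c d) :=
    h1.continuousOn_mul hk.continuousOn isCompact_Icc
  refine h2.integrable_of_ae_notMem_eq_zero ?_
  filter_upwards [hsupp] with x hx hxn
  rw [hx hxn, mul_zero]

/-- The outgoing component of the potential. -/
noncomputable def leftPart (f : ℝ → ℝ) (τ x : ℝ) : ℝ :=
  Real.exp (-τ * x) * ∫ y in Iic x, Real.exp (τ * y) * f y

/-- The incoming component of the potential. -/
noncomputable def rightPart (f : ℝ → ℝ) (τ x : ℝ) : ℝ :=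
  Real.exp (τ * x) * ∫ y in Ioi x, Real.exp (-τ * y) * f y

/-- The weak derivative of `vPotential` in space. -/
noncomputable def vDeriv (f : ℝ → ℝ) (x τ : ℝ) : ℝ :=
  1 / 2 * (rightPart f τ x - leftPart f τ x)

section Potential

variable {f : ℝ → ℝ} (hint : ∀ k : ℝ → ℝ, Continuous k → Integrable (fun y => k y * f y))
include hint

lemma vPotential_eq (x τ : ℝ) :
    vPotential f x τ = 1 / (2 * τ) * (leftPart f τ x + rightPart f τ x) := by
  have hk := hint (fun y => Real.exp (-τ * |x - y|)) (by fun_prop)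
  rw [vPotential, ← integral_add_compl (measurableSet_Iic (a := x)) hk, leftPart, rightPart,
    ← integral_const_mul, ← integral_const_mul, compl_Iic]
  congr 2
  · refine setIntegral_congr_fun measurableSet_Iic fun y hy => ?_
    simp only [← mul_assoc, ← Real.exp_add, abs_of_nonneg (sub_nonneg.2 (mem_Iic.1 hy))]
    ring_nf
  · refine setIntegral_congr_fun measurableSet_Ioi fun y hy => ?_
    simp only [← mul_assoc, ← Real.exp_add, abs_of_neg (sub_neg.2 (mem_Ioi.1 hy))]
    ring_nf

/-- The two halves of v solve first-order equations with opposite signs before `f`: in their sum the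
`f` terms cancel, giving `vDeriv`, and in their difference they add up to the source of the
second-order equation. -/
lemma isPrimitiveOn_leftPart (τ : ℝ) :
    IsPrimitiveOn (leftPart f τ) (fun x => -τ * leftPart f τ x + f x) univ := by
  have hk := hint (fun y => Real.exp (τ * y)) (by fun_prop)
  have h1 : IsPrimitiveOn (fun x => ∫ y in Iic x, Real.exp (τ * y) * f y)
      (fun y => Real.exp (τ * y) * f y) univ := fun x _ y _ =>
    ⟨hk.intervalIntegrable, (intervalIntegral.integral_Iic_sub_Iic hk.integrableOn
      hk.integrableOn).symm⟩
  have h2 : IsPrimitiveOn (fun x => Real.exp (-τ * x)) (fun x => -τ * Real.exp (-τ * x)) univ :=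
    IsPrimitiveOn.of_hasDerivAt (fun x => by
      simpa [mul_comm] using ((hasDerivAt_id x).const_mul (-τ)).exp) (by fun_prop)
  refine (h2.mul h1).congr_deriv fun x => ?_
  rw [← mul_assoc (Real.exp (-τ * x)), ← Real.exp_add, leftPart]
  simp [mul_assoc]

lemma isPrimitiveOn_rightPart (τ : ℝ) :
    IsPrimitiveOn (rightPart f τ) (fun x => τ * rightPart f τ x - f x) univ := by
  have hk := hint (fun y => Real.exp (-τ * y)) (by fun_prop)
  have h1 : IsPrimitiveOn (fun x => ∫ y in Ioi x, Real.exp (-τ * y) * f y)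
      (fun y => -1 * (Real.exp (-τ * y) * f y)) univ := fun x _ y _ => by
    refine ⟨(hk.const_mul _).intervalIntegrable, ?_⟩
    rw [intervalIntegral.integral_const_mul, ← intervalIntegral.integral_Ioi_sub_Ioi'
      hk.integrableOn hk.integrableOn]
    ring
  have h2 : IsPrimitiveOn (fun x => Real.exp (τ * x)) (fun x => τ * Real.exp (τ * x)) univ :=
    IsPrimitiveOn.of_hasDerivAt (fun x => by
      simpa [mul_comm] using ((hasDerivAt_id x).const_mul τ).exp) (by fun_prop)
  refine (h2.mul h1).congr_deriv fun x => ?_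
  have : Real.exp (τ * x) * Real.exp (-τ * x) = 1 := by rw [← Real.exp_add]; simp
  rw [rightPart]
  linear_combination (-f x) * this

lemma isPrimitiveOn_vPotential {τ : ℝ} (hτ : τ ≠ 0) :
    IsPrimitiveOn (fun x => vPotential f x τ) (fun x => vDeriv f x τ) univ := by
  simp_rw [vPotential_eq hint]
  refine (((isPrimitiveOn_leftPart hint τ).add (isPrimitiveOn_rightPart hint τ)).const_mul
    (1 / (2 * τ))).congr_deriv fun x => ?_
  rw [vDeriv]
  field_simp
  ring

lemma isPrimitiveOn_vDeriv (τ : ℝ) :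
    IsPrimitiveOn (fun x => vDeriv f x τ) (fun x => τ ^ 2 * vPotential f x τ - f x) univ := by
  simp_rw [vPotential_eq hint]
  have := ((isPrimitiveOn_rightPart hint τ).add
    ((isPrimitiveOn_leftPart hint τ).const_mul (-1))).const_mul (1 / 2)
  have e : (fun x => 1 / 2 * (rightPart f τ x + -1 * leftPart f τ x)) =
      fun x => vDeriv f x τ := funext fun x => by rw [vDeriv]; ring
  rw [e] at this
  refine this.congr_deriv fun x => ?_
  field_simp
  ring

/-- Treats both halves at once, with l = ±1. For τ ≥ 1 the exponent satisfies τl(x − y) ≤ −|x − y| ≤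
|y| − |x|, whence a bound uniform in τ. -/
lemma abs_exp_mul_le (τ x : ℝ) (hτ : 1 ≤ τ) (s : Set ℝ) (hs : MeasurableSet s) (l : ℝ)
    (h : ∀ y ∈ s, l * (x - y) ≤ -|x - y|) :
    |Real.exp (τ * l * x) * ∫ y in s, Real.exp (-(τ * l) * y) * f y| ≤
      Real.exp (-|x|) * ∫ y, Real.exp |y| * |f y| := by
  have hN : Integrable (fun y => Real.exp |y| * |f y|) := by
    have := (hint (fun y => Real.exp |y|) (by fun_prop)).abs
    simpa [abs_mul, abs_of_pos (Real.exp_pos _)] using this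
  rw [← integral_const_mul, ← integral_const_mul]
  have h2 : ∀ y ∈ s, ‖Real.exp (τ * l * x) * (Real.exp (-(τ * l) * y) * f y)‖ ≤
      Real.exp (-|x|) * (Real.exp |y| * |f y|) := fun y hy => by
    rw [← mul_assoc, ← mul_assoc, ← Real.exp_add, ← Real.exp_add, norm_mul, Real.norm_eq_abs,
      Real.norm_eq_abs, abs_of_pos (Real.exp_pos _)]
    refine mul_le_mul_of_nonneg_right (Real.exp_le_exp.2 ?_) (abs_nonneg _)
    have h3 := abs_sub_abs_le_abs_sub x y
    have h4 := h y hy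
    have h5 := abs_nonneg (x - y)
    have h6 := mul_le_mul_of_nonneg_left h4 (by linarith : 0 ≤ τ)
    nlinarith
  refine (norm_integral_le_of_norm_le (hN.const_mul _).integrableOn
    ((ae_restrict_iff' hs).2 (ae_of_all _ h2))).trans ?_
  exact setIntegral_le_integral (hN.const_mul _) (ae_of_all _ fun y => by positivity)

lemma abs_leftPart_le {τ : ℝ} (hτ : 1 ≤ τ) (x : ℝ) :
    |leftPart f τ x| ≤ Real.exp (-|x|) * ∫ y, Real.exp |y| * |f y| := by
  have := abs_exp_mul_le hint τ x hτ (Iic x) measurableSet_Iic (-1)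
    (fun y hy => by rw [abs_of_nonneg (sub_nonneg.2 (mem_Iic.1 hy))]; linarith)
  simpa [leftPart] using this

lemma abs_rightPart_le {τ : ℝ} (hτ : 1 ≤ τ) (x : ℝ) :
    |rightPart f τ x| ≤ Real.exp (-|x|) * ∫ y, Real.exp |y| * |f y| := by
  have := abs_exp_mul_le hint τ x hτ (Ioi x) measurableSet_Ioi 1
    (fun y hy => by rw [abs_of_neg (sub_neg.2 (mem_Ioi.1 hy))]; linarith)
  simpa [rightPart] using this

lemma abs_vDeriv_le {τ : ℝ} (hτ : 1 ≤ τ) (x : ℝ) :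
    |vDeriv f x τ| ≤ (∫ y, Real.exp |y| * |f y|) * Real.exp (-|x|) := by
  have h1 := abs_le.1 (abs_leftPart_le hint hτ x)
  have h2 := abs_le.1 (abs_rightPart_le hint hτ x)
  rw [vDeriv, abs_le]
  constructor <;> linarith

lemma abs_vPotential_le {τ : ℝ} (hτ : 1 ≤ τ) (x : ℝ) :
    |vPotential f x τ| ≤ (∫ y, Real.exp |y| * |f y|) * Real.exp (-|x|) := by
  have h1 := abs_leftPart_le hint hτ x
  have h2 := abs_rightPart_le hint hτ x
  rw [vPotential_eq hint, abs_mul, abs_of_pos (by positivity)]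
  have h3 : 1 / (2 * τ) ≤ 1 / 2 := one_div_le_one_div_of_le (by norm_num) (by linarith)
  have h4 := abs_add_le (leftPart f τ x) (rightPart f τ x)
  have h5 := abs_nonneg (leftPart f τ x + rightPart f τ x)
  calc _ ≤ 1 / 2 * |leftPart f τ x + rightPart f τ x| := by gcongr
    _ ≤ _ := by linarith

end Potential

/-! ### Testing the weak formulation with products G(x)θ(t) -/

lemma IsTestOn.deriv {s : Set ℝ} {θ : ℝ → ℝ} (h : IsTestOn s θ) : IsTestOn s (deriv θ) :=
  ⟨(contDiff_infty_iff_deriv.1 h.1).2, h.2.1.deriv, (tsupport_deriv_subset).trans h.2.2⟩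

section Fubini

variable {a T : ℝ} {U : ℝ → ℝ → ℝ} {ψ θ : ℝ → ℝ}

lemma integrable_prod_mul
    (hU : MemLp (Function.uncurry U) 2 (volume.restrict (Iio a ×ˢ Ioo 0 T)))
    (hψ : MemLp ψ 2 (volume.restrict (Iio a))) :
    Integrable (Function.uncurry fun x t => U x t * ψ x)
      ((volume.restrict (Iio a)).prod (volume.restrict (Ioo 0 T))) := by
  rw [Measure.volume_eq_prod, ← Measure.prod_restrict] at hU
  exact hU.integrable_mul (hψ.comp_fst _)

lemma integrable_prod_mul_mul
    (hU : MemLp (Function.uncurry U) 2 (volume.restrict (Iio a ×ˢ Ioo 0 T)))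
    (hψ : MemLp ψ 2 (volume.restrict (Iio a))) (hθ : Continuous θ) :
    Integrable (Function.uncurry fun x t => U x t * ψ x * θ t)
      ((volume.restrict (Iio a)).prod (volume.restrict (Ioo 0 T))) := by
  obtain ⟨C, hC⟩ := isCompact_Icc.exists_bound_of_continuousOn (hθ.continuousOn (s := Icc 0 T))
  refine (integrable_prod_mul hU hψ).mul_bdd (c := C)
    (hθ.comp continuous_snd).aestronglyMeasurable ?_
  rw [Measure.prod_restrict]
  refine (ae_restrict_iff' (measurableSet_Iio.prod measurableSet_Ioo)).2 (ae_of_all _ fun p hp => ?_)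
  exact hC _ (Ioo_subset_Icc_self hp.2)

lemma integrable_inner_mul
    (hU : MemLp (Function.uncurry U) 2 (volume.restrict (Iio a ×ˢ Ioo 0 T)))
    (hψ : MemLp ψ 2 (volume.restrict (Iio a))) (hθ : Continuous θ) :
    IntegrableOn (fun t => (∫ x in Iio a, U x t * ψ x) * θ t) (Ioo 0 T) := by
  have := (integrable_prod_mul_mul hU hψ hθ).integral_prod_right
  simpa only [Function.uncurry, integral_mul_const] using! this

/-- Brings the time integral inside, where the weak time derivative is available for almost every x.
-/
lemma integral_inner_mul
    (hU : MemLp (Function.uncurry U) 2 (volume.restrict (Iio a ×ˢ Ioo 0 T)))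
    (hψ : MemLp ψ 2 (volume.restrict (Iio a))) (hθ : Continuous θ) :
    ∫ t in Ioo 0 T, (∫ x in Iio a, U x t * ψ x) * θ t =
      ∫ x in Iio a, ψ x * ∫ t in Ioo 0 T, U x t * θ t := by
  have := integral_integral_swap (integrable_prod_mul_mul hU hψ hθ)
  simp only [← integral_const_mul, ← integral_mul_const]
  rw [← this]
  exact integral_congr_ae (ae_of_all _ fun x => integral_congr_ae (ae_of_all _ fun t => by ring))

end Fubini

/-- The weak formulation tested with the product of a solution of the stationary problem and a
test function in time. -/
lemma IsWeakSolution.integral_identity {a T γ β : ℝ} {f : ℝ → ℝ} {u : ℝ → ℝ → ℝ}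
    (hu : IsWeakSolution a T γ β f u) (hf : MemLp f 2 volume) :
    MemLp (Function.uncurry u) 2 (volume.restrict (Iio a ×ˢ Ioo 0 T)) ∧
    ∃ h : ℝ → ℝ, MemLp h 2 (volume.restrict (Ioo 0 T)) ∧
    ∀ (τ : ℝ) (G Gd : ℝ → ℝ), IsPrimitiveOn G Gd (Iic a) →
    IsPrimitiveOn Gd (fun x => τ ^ 2 * G x - f x) (Iic a) →
    MemLp G 2 (volume.restrict (Iio a)) → MemLp Gd 2 (volume.restrict (Iio a)) →
    Gd a + (γ * τ + β) * G a = 0 → ∀ θ : ℝ → ℝ, IsTestOn (Iio T) θ →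
    ∫ t in Ioo 0 T, (∫ x in Iio a, u x t * f x) * θ t =
      (∫ x in Iio a, f x * G x) * θ 0
      - (∫ t in Ioo 0 T, (∫ x in Iio a, u x t * G x) * (deriv (deriv θ) t - τ ^ 2 * θ t))
      + γ * G a * ∫ t in Ioo 0 T, h t * (deriv θ t + τ * θ t) := by
  obtain ⟨ux, ut, h, hu2, hux, hh, hH1, hut, hder, hweak⟩ := hu
  refine ⟨hu2, h, hh, fun τ G Gd hG hGd hGm hGdm hbc θ hθ => ?_⟩
  have hfm : MemLp f 2 (volume.restrict (Iio a)) := hf.restrict _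
  have hgm : MemLp (fun x => τ ^ 2 * G x - f x) 2 (volume.restrict (Iio a)) :=
    (hGm.const_mul _).sub hfm
  have hw := hweak G Gd (G a) (hG.memH1 hGm hGdm) θ hθ
  have c0 : Continuous θ := hθ.1.continuous
  have c1 : Continuous (deriv θ) := hθ.deriv.1.continuous
  have c2 : Continuous (deriv (deriv θ)) := hθ.deriv.deriv.1.continuous
  have hhθ : ∀ k : ℝ → ℝ, IsTestOn (Iio T) k → IntegrableOn (fun t => h t * k t) (Ioo 0 T) :=
    fun k hk => by
      have h3 : MemLp k 2 (volume.restrict (Ioo 0 T)) :=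
        (hk.1.continuous.memLp_of_hasCompactSupport hk.2.1).restrict _
      exact hh.integrable_mul h3
  -- integration by parts in time
  have e1 : ∫ t in Ioo 0 T, (∫ x in Iio a, ut x t * G x) * deriv θ t =
      -∫ t in Ioo 0 T, (∫ x in Iio a, u x t * G x) * deriv (deriv θ) t := by
    rw [integral_inner_mul hut hGm c1, integral_inner_mul hu2 hGm c2, ← integral_neg]
    -- `deriv θ` need not vanish at 0; there is no boundary term because u(0) = 0 is built into
    -- `hder`.
    refine integral_congr_ae ((hder _ hθ.deriv).mono fun x hx => ?_)
    simp only [hx]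
    ring
  -- integration by parts in space
  have e2 : ∀ᵐ t ∂(volume.restrict (Ioo 0 T)),
      (∫ x in Iio a, ux x t * Gd x) = (∫ x in Iio a, u x t * f x)
        - τ ^ 2 * (∫ x in Iio a, u x t * G x) - (γ * τ + β) * (h t * G a) := by
    filter_upwards [hH1] with t ht
    have k1 := ht.integral_mul_add hGd hGdm hgm
    have i1 : IntegrableOn (fun x => u x t * G x) (Iio a) := ht.memLp.integrable_mul hGm
    have i2 : IntegrableOn (fun x => u x t * f x) (Iio a) := ht.memLp.integrable_mul hfm
    have k2 : ∫ x in Iio a, u x t * (τ ^ 2 * G x - f x) =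
        τ ^ 2 * (∫ x in Iio a, u x t * G x) - ∫ x in Iio a, u x t * f x := by
      rw [← integral_const_mul, ← integral_sub (i1.const_mul _) i2]
      exact integral_congr_ae (ae_of_all _ fun x => by ring)
    rw [k2] at k1
    -- The boundary condition on `G` replaces `Gd a`. Its β part will cancel the β term of the weak
    -- form, leaving only θ' + τθ at the boundary, which vanishes for e^{-τt}.
    linear_combination k1 + h t * hbc
  have j1 := integrable_inner_mul hut hGm c1
  have j2 := integrable_inner_mul hu2 hGm c2
  have j3 := integrable_inner_mul hu2 hGm c0
  have j4 := integrable_inner_mul hu2 hfm c0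
  have j5 := hhθ _ hθ
  have j6 := hhθ _ hθ.deriv
  have e3 : (∫ x in Iio a, f x * G x) * θ 0 =
      (∫ t in Ioo 0 T, (∫ x in Iio a, u x t * f x) * θ t)
      - (∫ t in Ioo 0 T, (∫ x in Iio a, ut x t * G x) * deriv θ t)
      - (γ * G a) * (∫ t in Ioo 0 T, h t * deriv θ t)
      - (γ * G a * τ) * (∫ t in Ioo 0 T, h t * θ t)
      - τ ^ 2 * (∫ t in Ioo 0 T, (∫ x in Iio a, u x t * G x) * θ t) := by
    rw [← hw, ← integral_const_mul, ← integral_const_mul, ← integral_const_mul,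
      ← integral_sub j4 j1, ← integral_sub, ← integral_sub, ← integral_sub]
    rotate_left
    · exact ((j4.sub j1).sub (j6.const_mul _)).sub (j5.const_mul _)
    · exact j3.const_mul _
    · exact (j4.sub j1).sub (j6.const_mul _)
    · exact j5.const_mul _
    · exact j4.sub j1
    · exact j6.const_mul _
    refine integral_congr_ae (e2.mono fun t ht => ?_)
    simp only [ht]
    ring
  have e4 : ∫ t in Ioo 0 T, (∫ x in Iio a, u x t * G x) * (deriv (deriv θ) t - τ ^ 2 * θ t) =
      (∫ t in Ioo 0 T, (∫ x in Iio a, u x t * G x) * deriv (deriv θ) t)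
      - τ ^ 2 * (∫ t in Ioo 0 T, (∫ x in Iio a, u x t * G x) * θ t) := by
    rw [← integral_const_mul, ← integral_sub j2 (j3.const_mul _)]
    exact integral_congr_ae (ae_of_all _ fun x => by ring)
  have e5 : ∫ t in Ioo 0 T, h t * (deriv θ t + τ * θ t) =
      (∫ t in Ioo 0 T, h t * deriv θ t) + τ * (∫ t in Ioo 0 T, h t * θ t) := by
    rw [← integral_const_mul, ← integral_add j6 (j5.const_mul _)]
    exact integral_congr_ae (ae_of_all _ fun x => by ring)
  rw [e4, e5]
  rw [e1] at e3
  linear_combination -e3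

/-! ### Exponential bounds and cutoffs in time -/

lemma memLp_exp_Iio (a : ℝ) : MemLp Real.exp 2 (volume.restrict (Iio a)) := by
  refine (memLp_two_iff_integrable_sq Real.continuous_exp.aestronglyMeasurable).2 ?_
  have := (integrableOn_exp_mul_Iic (a := 2) (by norm_num) a).mono_set Iio_subset_Iic_self
  refine this.congr (ae_of_all _ fun x => ?_)
  simp only [← Real.exp_nat_mul]
  norm_num

lemma IsPrimitiveOn.memLp_of_abs_le {a K : ℝ} {P k : ℝ → ℝ} (hP : IsPrimitiveOn P k (Iic a))
    (h : ∀ x ≤ a, |P x| ≤ K * Real.exp x) : MemLp P 2 (volume.restrict (Iio a)) := by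
  refine ((memLp_exp_Iio a).const_mul K).mono hP.locallyIntegrable.aestronglyMeasurable ?_
  refine (ae_restrict_iff' measurableSet_Iio).2 (ae_of_all _ fun x hx => ?_)
  exact (h x (mem_Iio.1 hx).le).trans (le_abs_self _)

lemma abs_setIntegral_mul_le {s : Set ℝ} (hs : MeasurableSet s) {A M ρ : ℝ → ℝ} {c : ℝ}
    (hc : 0 ≤ c)
    (hA : ∀ᵐ t ∂(volume.restrict s), |A t| ≤ M t) (hM : IntegrableOn M s)
    (hρ : ∀ t ∈ s, |ρ t| ≤ c) : |∫ t in s, A t * ρ t| ≤ c * ∫ t in s, M t := by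
  rw [← integral_const_mul]
  refine norm_integral_le_of_norm_le (f := fun t => A t * ρ t) (hM.const_mul c) ?_
  filter_upwards [hA, ae_restrict_mem hs] with t ht hts
  rw [norm_mul, mul_comm]
  exact mul_le_mul (hρ t hts) ht (abs_nonneg _) hc

lemma exists_cutoff {S T : ℝ} (hS : 0 < S) (hST : S < T) :
    ∃ (χ : ℝ → ℝ) (K : ℝ), IsTestOn (Iio T) χ ∧ 0 ≤ K ∧ (∀ t, 0 ≤ χ t ∧ χ t ≤ 1) ∧
      (∀ t, |deriv χ t| ≤ K) ∧ (∀ t, |deriv (deriv χ) t| ≤ K) ∧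
      ∀ t, 0 ≤ t → t < S → χ t = 1 ∧ deriv χ t = 0 ∧ deriv (deriv χ) t = 0 := by
  let χ : ContDiffBump (0 : ℝ) := ⟨S, (S + T) / 2, hS, by linarith⟩
  have hχ : IsTestOn (Iio T) (χ : ℝ → ℝ) := by
    refine ⟨χ.contDiff, χ.hasCompactSupport, fun x hx => ?_⟩
    rw [χ.tsupport_eq, mem_closedBall_zero_iff, Real.norm_eq_abs] at hx
    have : |x| ≤ (S + T) / 2 := hx
    have := le_abs_self x
    rw [mem_Iio]; linarith
  obtain ⟨K1, hK1⟩ := hχ.deriv.2.1.exists_bound_of_continuous hχ.deriv.1.continuous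
  obtain ⟨K2, hK2⟩ := hχ.deriv.deriv.2.1.exists_bound_of_continuous hχ.deriv.deriv.1.continuous
  refine ⟨χ, max 0 (max K1 K2), hχ, le_max_left _ _, fun t => ⟨χ.nonneg, χ.le_one⟩,
    fun t => (hK1 t).trans (by simp), fun t => (hK2 t).trans (by simp), fun t h0 ht => ?_⟩
  have hb : t ∈ Metric.ball (0 : ℝ) S := by
    rw [mem_ball_zero_iff, Real.norm_eq_abs, abs_of_nonneg h0]; exact ht
  have e : (χ : ℝ → ℝ) =ᶠ[𝓝 t] fun _ => 1 := by
    filter_upwards [Metric.isOpen_ball.mem_nhds hb] with y hy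
    exact χ.one_of_mem_closedBall (Metric.ball_subset_closedBall hy)
  refine ⟨e.self_of_nhds, by rw [e.deriv_eq, deriv_const], ?_⟩
  rw [e.deriv.deriv_eq]
  simp

lemma isTestOn_exp_mul {s : Set ℝ} {χ : ℝ → ℝ} (h : IsTestOn s χ) (τ : ℝ) :
    IsTestOn s (fun t => Real.exp (-τ * t) * χ t) :=
  ⟨ContDiff.mul (by fun_prop) h.1, h.2.1.mul_left,
    (closure_mono (Function.support_mul_subset_right _ _)).trans h.2.2⟩

lemma deriv_exp_mul {s : Set ℝ} {χ : ℝ → ℝ} (h : IsTestOn s χ) (τ : ℝ) :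
    deriv (fun t => Real.exp (-τ * t) * χ t) =
      fun t => Real.exp (-τ * t) * (deriv χ t - τ * χ t) := funext fun t => by
  have h1 : HasDerivAt (fun t => Real.exp (-τ * t)) (-τ * Real.exp (-τ * t)) t := by
    simpa [mul_comm] using ((hasDerivAt_id t).const_mul (-τ)).exp
  rw [(h1.fun_mul (h.1.differentiable (by simp) t).hasDerivAt).deriv]
  ring

lemma deriv_deriv_exp_mul {s : Set ℝ} {χ : ℝ → ℝ} (h : IsTestOn s χ) (τ : ℝ) :
    deriv (deriv (fun t => Real.exp (-τ * t) * χ t)) =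
      fun t => Real.exp (-τ * t) * (deriv (deriv χ) t - 2 * τ * deriv χ t + τ ^ 2 * χ t) := by
  rw [deriv_exp_mul h]
  have e : (fun t => Real.exp (-τ * t) * (deriv χ t - τ * χ t)) = fun t =>
    Real.exp (-τ * t) * deriv χ t - τ * (Real.exp (-τ * t) * χ t) := funext fun t => by ring
  rw [e]
  funext t
  have d1 := (isTestOn_exp_mul h.deriv τ).1.differentiable (by simp) t
  have d2 := (isTestOn_exp_mul h τ).1.differentiable (by simp) t
  rw [deriv_fun_sub d1 (d2.const_mul τ), deriv_const_mul _ d2, deriv_exp_mul h.deriv, deriv_exp_mul h]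
  ring

/-! ### The stationary problem and its reflected wave -/

/-- The coefficient of the reflected wave in the stationary problem. -/
noncomputable def reflectionCoeff (γ β τ : ℝ) : ℝ := (τ - γ * τ - β) / (τ + γ * τ + β)

lemma reflectionCoeff_denom_pos {γ β τ : ℝ} (hγ : 0 ≤ γ) (hτ : 1 + 2 * |β| ≤ τ) :
    0 < τ + γ * τ + β := by
  have h1 := neg_abs_le β
  have h2 := abs_nonneg β
  have h3 : 0 ≤ γ * τ := mul_nonneg hγ (by linarith)
  linarith

/-- The threshold on τ gives |β| ≤ τ/2, so the denominator is at least τ/2 + γτ and dominates a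
third of the numerator. -/
lemma abs_reflectionCoeff_le {γ β τ : ℝ} (hγ : 0 ≤ γ) (hτ : 1 + 2 * |β| ≤ τ) :
    |reflectionCoeff γ β τ| ≤ 3 := by
  have hp := reflectionCoeff_denom_pos hγ hτ
  have h1 := neg_abs_le β
  have h2 := abs_nonneg β
  have h3 : 0 ≤ γ * τ := mul_nonneg hγ (by linarith)
  have h4 := le_abs_self β
  rw [reflectionCoeff, abs_div, abs_of_pos hp, div_le_iff₀ hp, abs_le]
  constructor <;> linarith

/-- The solution of the stationary problem. -/
noncomputable def stationary (f : ℝ → ℝ) (a C τ x : ℝ) : ℝ :=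
  vPotential f x τ + C * Real.exp (τ * (x - a))

/-- The weak derivative of `stationary`. -/
noncomputable def stationaryDeriv (f : ℝ → ℝ) (a C τ x : ℝ) : ℝ :=
  vDeriv f x τ + C * (τ * Real.exp (τ * (x - a)))

section Stationary

variable {f : ℝ → ℝ} {a C τ : ℝ}

lemma isPrimitiveOn_exp (a τ : ℝ) (s : Set ℝ) : IsPrimitiveOn (fun x => Real.exp (τ * (x - a)))
    (fun x => τ * Real.exp (τ * (x - a))) s :=
  IsPrimitiveOn.of_hasDerivAt (fun x => by
    simpa [mul_comm] using (((hasDerivAt_id x).sub_const a).const_mul τ).exp) (by fun_prop)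

lemma isPrimitiveOn_stationary (hint : ∀ k : ℝ → ℝ, Continuous k → Integrable (fun y => k y * f y))
    (hτ : τ ≠ 0) (s : Set ℝ) :
    IsPrimitiveOn (stationary f a C τ) (stationaryDeriv f a C τ) s :=
  ((isPrimitiveOn_vPotential hint hτ).mono (subset_univ s)).add
    ((isPrimitiveOn_exp a τ s).const_mul C)

lemma isPrimitiveOn_stationaryDeriv
    (hint : ∀ k : ℝ → ℝ, Continuous k → Integrable (fun y => k y * f y)) (s : Set ℝ) :
    IsPrimitiveOn (stationaryDeriv f a C τ) (fun x => τ ^ 2 * stationary f a C τ x - f x) s :=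
  (((isPrimitiveOn_vDeriv hint τ).mono (subset_univ s)).add
    (((isPrimitiveOn_exp a τ s).const_mul τ).const_mul C)).congr_deriv fun x => by
      rw [stationary]; ring

lemma exp_mul_sub_le (ha : 0 ≤ a) (hτ : 1 ≤ τ) {x : ℝ} (hx : x ≤ a) :
    Real.exp (τ * (x - a)) ≤ Real.exp x :=
  Real.exp_le_exp.2 (by nlinarith)

lemma abs_stationary_le (hint : ∀ k : ℝ → ℝ, Continuous k → Integrable (fun y => k y * f y))
    (ha : 0 ≤ a) (hτ : 1 ≤ τ) {x : ℝ} (hx : x ≤ a) :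
    |stationary f a C τ x| ≤ ((∫ y, Real.exp |y| * |f y|) + |C|) * Real.exp x := by
  have h1 := abs_vPotential_le hint hτ x
  have hN : 0 ≤ ∫ y, Real.exp |y| * |f y| := integral_nonneg fun y => by positivity
  have h2 : Real.exp (-|x|) ≤ Real.exp x := Real.exp_le_exp.2 (neg_abs_le x)
  rw [stationary, add_mul]
  refine (abs_add_le _ _).trans (add_le_add (h1.trans (by gcongr)) ?_)
  rw [abs_mul, abs_of_pos (Real.exp_pos _)]
  exact mul_le_mul_of_nonneg_left (exp_mul_sub_le ha hτ hx) (abs_nonneg _)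

lemma abs_stationaryDeriv_le (hint : ∀ k : ℝ → ℝ, Continuous k → Integrable (fun y => k y * f y))
    (ha : 0 ≤ a) (hτ : 1 ≤ τ) {x : ℝ} (hx : x ≤ a) :
    |stationaryDeriv f a C τ x| ≤ ((∫ y, Real.exp |y| * |f y|) + |C| * τ) * Real.exp x := by
  have h1 := abs_vDeriv_le hint hτ x
  have hN : 0 ≤ ∫ y, Real.exp |y| * |f y| := integral_nonneg fun y => by positivity
  have h2 : Real.exp (-|x|) ≤ Real.exp x := Real.exp_le_exp.2 (neg_abs_le x)
  have h3 : 0 ≤ τ := by linarith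
  rw [stationaryDeriv, add_mul]
  refine (abs_add_le _ _).trans (add_le_add (h1.trans (by gcongr)) ?_)
  rw [← mul_assoc, abs_mul, abs_of_pos (Real.exp_pos _), abs_mul, abs_of_nonneg h3]
  exact mul_le_mul_of_nonneg_left (exp_mul_sub_le ha hτ hx) (by positivity)

end Stationary

/-! ### Consequences of the support of f -/

section Support

variable {f : ℝ → ℝ} {a b c : ℝ}

lemma rightPart_eq_zero (hsupp : ∀ᵐ x ∂(volume : Measure ℝ), x ∉ Icc c b → f x = 0) (hab : b < a)
    (τ : ℝ) : rightPart f τ a = 0 := by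
  have : ∫ y in Ioi a, Real.exp (-τ * y) * f y = 0 := by
    refine (setIntegral_congr_ae (g := fun _ => (0 : ℝ)) measurableSet_Ioi ?_).trans (by simp)
    filter_upwards [hsupp] with x hx hxa
    rw [hx fun h => absurd (mem_Ioi.1 hxa) (by linarith [h.2]), mul_zero]
  rw [rightPart, this, mul_zero]

lemma leftPart_eq (f : ℝ → ℝ) (a τ : ℝ) : leftPart f τ a = ∫ x in Iio a, f x * Real.exp (τ * (x - a)) := by
  rw [leftPart, integral_Iic_eq_integral_Iio, ← integral_const_mul]
  refine setIntegral_congr_fun measurableSet_Iio fun y _ => ?_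
  simp only [← mul_assoc, ← Real.exp_add]
  rw [mul_comm (f y)]
  ring_nf

lemma setIntegral_Icc_eq (hsupp : ∀ᵐ x ∂(volume : Measure ℝ), x ∉ Icc c b → f x = 0) (hab : b < a)
    (k : ℝ → ℝ) : ∫ x in Icc c b, f x * k x = ∫ x in Iio a, f x * k x := by
  rw [setIntegral_eq_integral_of_ae_compl_eq_zero, setIntegral_eq_integral_of_ae_compl_eq_zero]
  · filter_upwards [hsupp] with x hx hxa
    rw [hx fun h => hxa (h.2.trans_lt hab), zero_mul]
  · filter_upwards [hsupp] with x hx hxa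
    rw [hx hxa, zero_mul]

/-- Separates the decay over the distance from b to a from the integral whose size is controlled by
hypothesis. -/
lemma leftPart_eq_exp_mul (hsupp : ∀ᵐ x ∂(volume : Measure ℝ), x ∉ Icc c b → f x = 0)
    (hab : b < a) (hcb : c ≤ b) (τ : ℝ) :
    leftPart f τ a = Real.exp (-τ * (a - b)) * ∫ y in c..b, Real.exp (-τ * (b - y)) * f y := by
  rw [leftPart_eq, ← setIntegral_Icc_eq hsupp hab, intervalIntegral.integral_of_le hcb,
    integral_Icc_eq_integral_Ioc, ← integral_const_mul]
  refine setIntegral_congr_fun measurableSet_Ioc fun y _ => ?_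
  simp only [← mul_assoc, ← Real.exp_add]
  rw [mul_comm (f y)]
  ring_nf

end Support

/-! ### The data as reflected term plus small error -/

lemma backScatteringData_eq {f : ℝ → ℝ} {a b c T τ : ℝ} {u : ℝ → ℝ → ℝ}
    (hf : MemLp f 2 volume) (hsupp : ∀ᵐ x ∂(volume : Measure ℝ), x ∉ Icc c b → f x = 0)
    (hab : b < a) (hu : MemLp (Function.uncurry u) 2 (volume.restrict (Iio a ×ˢ Ioo 0 T)))
    (hv : MemLp (fun x => vPotential f x τ) 2 (volume.restrict (Iio a))) :
    backScatteringData (Icc c b) T f u τ =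
      (∫ t in Ioo 0 T, (∫ x in Iio a, u x t * f x) * Real.exp (-τ * t))
      - ∫ x in Iio a, f x * vPotential f x τ := by
  have hfm : MemLp f 2 (volume.restrict (Iio a)) := hf.restrict _
  have hc : Continuous fun t => Real.exp (-τ * t) := by fun_prop
  have i1 : IntegrableOn (fun x => f x * vPotential f x τ) (Iio a) := hfm.integrable_mul hv
  have i2 : IntegrableOn (fun x => f x * ∫ t in Ioo 0 T, u x t * Real.exp (-τ * t)) (Iio a) := by
    have := (integrable_prod_mul_mul hu hfm hc).integral_prod_left
    refine this.congr (ae_of_all _ fun x => ?_)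
    simp only [Function.uncurry, ← integral_const_mul]
    exact integral_congr_ae (ae_of_all _ fun t => by ring)
  rw [backScatteringData, setIntegral_Icc_eq hsupp hab, integral_inner_mul hu hfm hc,
    ← integral_sub i2 i1]
  refine integral_congr_ae (ae_of_all _ fun x => ?_)
  simp only [wTransform, mul_sub]
  congr 3
  funext t
  rw [mul_comm]

/-- The reflected part of the data, up to an error which is exponentially small of any rate below
the observation time. -/
theorem exists_abs_backScatteringData_sub_le {f : ℝ → ℝ} {a b c T γ β S : ℝ} {u : ℝ → ℝ → ℝ}
    (hf : MemLp f 2 volume) (hsupp : ∀ᵐ x ∂(volume : Measure ℝ), x ∉ Icc c b → f x = 0)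
    (ha : 0 ≤ a) (hγ : 0 ≤ γ) (hab : b < a) (hS : 0 < S) (hST : S < T)
    (hu : IsWeakSolution a T γ β f u) :
    ∃ K : ℝ, ∀ τ : ℝ, 1 + 2 * |β| ≤ τ →
      |backScatteringData (Icc c b) T f u τ
        - leftPart f τ a ^ 2 / (2 * τ) * reflectionCoeff γ β τ| ≤ K * τ * Real.exp (-τ * S) := by
  have hint : ∀ k : ℝ → ℝ, Continuous k → Integrable (fun y => k y * f y) :=
    fun k hk => integrable_continuous_mul hf hsupp hk
  have hfm : MemLp f 2 (volume.restrict (Iio a)) := hf.restrict _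
  obtain ⟨hu2, h, hh, hid⟩ := hu.integral_identity hf
  obtain ⟨χ, K₀, hχ, hK₀, hχ01, hχ1, hχ2, hχS⟩ := exists_cutoff hS hST
  set N := ∫ y, Real.exp |y| * |f y|
  have hN : 0 ≤ N := integral_nonneg fun y => by positivity
  have hexp := memLp_exp_Iio a
  have m1 : IntegrableOn (fun t => |∫ x in Iio a, u x t * f x|) (Ioo 0 T) :=
    (integrable_prod_mul hu2 hfm).integral_prod_right.abs
  have hprod := integrable_prod_mul hu2 hexp
  have m2 : IntegrableOn (fun t => ∫ x in Iio a, |u x t * Real.exp x|) (Ioo 0 T) :=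
    hprod.abs.integral_prod_right
  have : IsFiniteMeasure (volume.restrict (Ioo 0 T)) := isFiniteMeasure_restrict.2 (by simp)
  have m3 : IntegrableOn (fun t => |h t|) (Ioo 0 T) := (hh.integrable (by norm_num)).abs
  set I1 := ∫ t in Ioo 0 T, |∫ x in Iio a, u x t * f x|
  set I2 := ∫ t in Ioo 0 T, ∫ x in Iio a, |u x t * Real.exp x|
  set I3 := ∫ t in Ioo 0 T, |h t|
  have hI1 : 0 ≤ I1 := integral_nonneg fun t => abs_nonneg _
  have hI2 : 0 ≤ I2 := integral_nonneg fun t => integral_nonneg fun x => abs_nonneg _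
  have hI3 : 0 ≤ I3 := integral_nonneg fun t => abs_nonneg _
  -- The three summands bound, in order, the error from replacing 1 by χ, the interior cutoff error
  -- and the boundary cutoff error. Only the second needs the factor τ, coming from 2τχ'.
  refine ⟨I1 + 3 * K₀ * (4 * N * I2) + γ * (4 * N * Real.exp a) * K₀ * I3, fun τ hτ => ?_⟩
  have hτ1 : 1 ≤ τ := by linarith [abs_nonneg β]
  have hτ0 : 0 < τ := by linarith
  have hden := reflectionCoeff_denom_pos hγ hτ
  have hva : vPotential f a τ = leftPart f τ a / (2 * τ) := by
    rw [vPotential_eq hint, rightPart_eq_zero hsupp hab]; ring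
  set L := leftPart f τ a
  set R := reflectionCoeff γ β τ
  set C := L / (2 * τ) * R
  have hC : |C| ≤ 3 * N := by
    have h1 := abs_vPotential_le hint hτ1 a
    rw [hva] at h1
    have h2 : Real.exp (-|a|) ≤ 1 := Real.exp_le_one_iff.2 (by simp)
    have h3 : |L / (2 * τ)| ≤ N := h1.trans (mul_le_of_le_one_right hN h2)
    rw [abs_mul, mul_comm 3]
    exact mul_le_mul h3 (abs_reflectionCoeff_le hγ hτ) (abs_nonneg _) hN
  have hG := isPrimitiveOn_stationary (a := a) (C := C) hint hτ0.ne' (Iic a)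
  have hGd := isPrimitiveOn_stationaryDeriv (a := a) (C := C) (τ := τ) hint (Iic a)
  -- 4N = N + 3N: the potential contributes N and the reflected wave |C| ≤ 3N.
  have hGb : ∀ x ≤ a, |stationary f a C τ x| ≤ 4 * N * Real.exp x := fun x hx =>
    (abs_stationary_le hint ha hτ1 hx).trans
      (mul_le_mul_of_nonneg_right (by linarith) (Real.exp_pos x).le)
  have hGm := hG.memLp_of_abs_le hGb
  have hGdm := hGd.memLp_of_abs_le fun x hx => abs_stationaryDeriv_le hint ha hτ1 hx
  -- Nothing comes in from the right of `a`, so v'(a) = −τv(a) and the condition reads C(τ + γτ + β)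
  -- = v(a)(τ − γτ − β). This determines `C`.
  have hbc : stationaryDeriv f a C τ a + (γ * τ + β) * stationary f a C τ a = 0 := by
    rw [stationaryDeriv, stationary, hva, vDeriv, rightPart_eq_zero hsupp hab]
    rw [sub_self, mul_zero, Real.exp_zero]
    have h1 : C * (τ + γ * τ + β) = L / (2 * τ) * (τ - γ * τ - β) := by
      simp only [C, R, reflectionCoeff]
      rw [mul_assoc, div_mul_cancel₀ _ hden.ne']
    have h2 : L / (2 * τ) * τ = L / 2 := by field_simp
    have h3 : L = leftPart f τ a := rfl
    linear_combination h1 + h2 + 1 / 2 * h3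
  have hθ := isTestOn_exp_mul hχ τ
  have key := hid τ _ _ hG hGd hGm hGdm hbc _ hθ
  have hvm : MemLp (fun x => vPotential f x τ) 2 (volume.restrict (Iio a)) :=
    ((isPrimitiveOn_vPotential hint hτ0.ne').mono (subset_univ _)).memLp_of_abs_le fun x _ =>
      (abs_vPotential_le hint hτ1 x).trans
        (mul_le_mul_of_nonneg_left (Real.exp_le_exp.2 (neg_abs_le x)) hN)
  have hdata := backScatteringData_eq (T := T) hf hsupp hab hu2 hvm
  -- The main term appears here: C·L = L²R/(2τ), because pairing `f` with the reflected exponential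
  -- gives `L` again.
  have hfG : ∫ x in Iio a, f x * stationary f a C τ x =
      (∫ x in Iio a, f x * vPotential f x τ) + C * L := by
    have i1 : IntegrableOn (fun x => f x * vPotential f x τ) (Iio a) := hfm.integrable_mul hvm
    have i2 : IntegrableOn (fun x => f x * Real.exp (τ * (x - a))) (Iio a) := by
      have := (hint (fun x => Real.exp (τ * (x - a))) (by fun_prop)).integrableOn (s := Iio a)
      simpa only [mul_comm] using this
    rw [show L = _ from leftPart_eq f a τ, ← integral_const_mul, ← integral_add i1 (i2.const_mul C)]
    exact integral_congr_ae (ae_of_all _ fun x => by simp only [stationary]; ring)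
  have hθ0 : Real.exp (-τ * 0) * χ 0 = 1 := by rw [(hχS 0 le_rfl hS).1]; simp
  have j1 := integrable_inner_mul hu2 hfm hθ.1.continuous
  have j2 : IntegrableOn (fun t => (∫ x in Iio a, u x t * f x) * Real.exp (-τ * t)) (Ioo 0 T) :=
    integrable_inner_mul hu2 hfm (by fun_prop)
  have hdiff : (∫ t in Ioo 0 T, (∫ x in Iio a, u x t * f x) * Real.exp (-τ * t)) -
      ∫ t in Ioo 0 T, (∫ x in Iio a, u x t * f x) * (Real.exp (-τ * t) * χ t) =
      ∫ t in Ioo 0 T, (∫ x in Iio a, u x t * f x) * (Real.exp (-τ * t) * (1 - χ t)) := by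
    rw [← integral_sub j2 j1]
    exact integral_congr_ae (ae_of_all _ fun x => by ring)
  simp only [deriv_deriv_exp_mul hχ] at key
  simp only [deriv_exp_mul hχ] at key
  rw [hθ0, mul_one, hfG] at key
  -- Common to all three errors: the factor vanishes for t < S, and e^{-τt} ≤ e^{-τS} afterwards.
  have hsmall : ∀ t : ℝ, 0 < t → ∀ k M : ℝ, 0 ≤ M → |k| ≤ M → (t < S → k = 0) →
      |Real.exp (-τ * t) * k| ≤ M * Real.exp (-τ * S) := fun t _ k M hM hk hk0 => by
    rcases lt_or_ge t S with hlt | hge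
    · rw [hk0 hlt, mul_zero, abs_zero]; positivity
    · rw [abs_mul, abs_of_pos (Real.exp_pos _), mul_comm]
      exact mul_le_mul hk (Real.exp_le_exp.2 (by nlinarith)) (Real.exp_pos _).le hM
  have b1 := abs_setIntegral_mul_le (A := fun t => ∫ x in Iio a, u x t * f x)
    (ρ := fun t => Real.exp (-τ * t) * (1 - χ t)) (c := 1 * Real.exp (-τ * S)) measurableSet_Ioo
    (by positivity) (ae_of_all _ fun t => le_rfl) m1 fun t ht =>
      hsmall t ht.1 _ _ zero_le_one
        (by rw [abs_le]; constructor <;> linarith [(hχ01 t).1, (hχ01 t).2])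
        (fun hlt => by rw [(hχS t ht.1.le hlt).1, sub_self])
  have b2 := abs_setIntegral_mul_le (A := fun t => ∫ x in Iio a, u x t * stationary f a C τ x)
    (M := fun t => 4 * N * ∫ x in Iio a, |u x t * Real.exp x|)
    (ρ := fun t => Real.exp (-τ * t) * (deriv (deriv χ) t - 2 * τ * deriv χ t + τ ^ 2 * χ t) -
      τ ^ 2 * (Real.exp (-τ * t) * χ t))
    (c := 3 * K₀ * τ * Real.exp (-τ * S)) measurableSet_Ioo
    (by positivity) ?_ (m2.const_mul _) fun t ht => ?_
  rotate_left
  · filter_upwards [hprod.prod_left_ae] with t ht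
    rw [← integral_const_mul]
    refine norm_integral_le_of_norm_le (f := fun x => u x t * stationary f a C τ x)
      (ht.abs.const_mul _) ((ae_restrict_iff' measurableSet_Iio).2 (ae_of_all _ fun x hx => ?_))
    rw [norm_mul, Real.norm_eq_abs, Real.norm_eq_abs, abs_mul, abs_of_pos (Real.exp_pos x)]
    have := mul_le_mul_of_nonneg_left (hGb x (mem_Iio.1 hx).le) (abs_nonneg (u x t))
    linarith
  -- The τ²χ terms cancel, and |χ'' − 2τχ'| ≤ K₀ + 2τK₀ ≤ 3K₀τ since τ ≥ 1.
  · have e : Real.exp (-τ * t) * (deriv (deriv χ) t - 2 * τ * deriv χ t + τ ^ 2 * χ t) -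
      τ ^ 2 * (Real.exp (-τ * t) * χ t) =
      Real.exp (-τ * t) * (deriv (deriv χ) t - 2 * τ * deriv χ t) := by ring
    rw [e]
    refine hsmall t ht.1 _ _ (by positivity) ?_ (fun hlt => by
      rw [(hχS t ht.1.le hlt).2.1, (hχS t ht.1.le hlt).2.2]; ring)
    refine (abs_sub _ _).trans ?_
    rw [abs_mul, abs_of_pos (by linarith : 0 < 2 * τ)]
    have h1 := mul_le_mul_of_nonneg_left (hχ1 t) (by linarith : 0 ≤ 2 * τ)
    have h2 := mul_le_mul_of_nonneg_right hτ1 hK₀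
    linarith [hχ2 t]
  have b3 := abs_setIntegral_mul_le (A := h)
    (ρ := fun t => Real.exp (-τ * t) * (deriv χ t - τ * χ t) + τ * (Real.exp (-τ * t) * χ t))
    (c := K₀ * Real.exp (-τ * S)) measurableSet_Ioo
    (by positivity) (ae_of_all _ fun t => le_rfl) m3 fun t ht => by
      have e : Real.exp (-τ * t) * (deriv χ t - τ * χ t) + τ * (Real.exp (-τ * t) * χ t) =
        Real.exp (-τ * t) * deriv χ t := by ring
      rw [e]
      exact hsmall t ht.1 _ _ hK₀ (hχ1 t) (fun hlt => (hχS t ht.1.le hlt).2.1)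
  rw [integral_const_mul] at b2
  set E1 := ∫ t in Ioo 0 T, (∫ x in Iio a, u x t * f x) * (Real.exp (-τ * t) * (1 - χ t))
  set E2 := ∫ t in Ioo 0 T, (∫ x in Iio a, u x t * stationary f a C τ x) *
    (Real.exp (-τ * t) * (deriv (deriv χ) t - 2 * τ * deriv χ t + τ ^ 2 * χ t) -
      τ ^ 2 * (Real.exp (-τ * t) * χ t))
  set E3 := ∫ t in Ioo 0 T, h t *
    (Real.exp (-τ * t) * (deriv χ t - τ * χ t) + τ * (Real.exp (-τ * t) * χ t))
  have hfin : backScatteringData (Icc c b) T f u τ - L ^ 2 / (2 * τ) * R =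
      E1 - E2 + γ * stationary f a C τ a * E3 := by
    rw [hdata]
    simp only [C] at key ⊢
    linear_combination hdiff + key
  rw [hfin]
  set X := Real.exp (-τ * S)
  have hX : 0 < X := Real.exp_pos _
  have b4 : |γ * stationary f a C τ a * E3| ≤ γ * (4 * N * Real.exp a) * (K₀ * X * I3) := by
    rw [abs_mul, abs_mul, abs_of_nonneg hγ]
    have := hGb a le_rfl
    gcongr
  have b5 := abs_add_le (E1 - E2) (γ * stationary f a C τ a * E3)
  have b6 := abs_sub E1 E2
  have q1 : X * I1 ≤ τ * (X * I1) := le_mul_of_one_le_left (by positivity) hτ1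
  have q3 : γ * (4 * N * Real.exp a) * (K₀ * X * I3) ≤
    τ * (γ * (4 * N * Real.exp a) * (K₀ * X * I3)) := le_mul_of_one_le_left (by positivity) hτ1
  calc _ ≤ 1 * X * I1 + 3 * K₀ * τ * X * (4 * N * I2) +
      γ * (4 * N * Real.exp a) * (K₀ * X * I3) := by linarith
    _ ≤ _ := by linarith

/-! ### Asymptotics: sign and logarithmic rate -/

lemma setDist_Ioi_Icc {a b c : ℝ} (hab : b < a) (hcb : c ≤ b) :
    setDist (Ioi a) (Icc c b) = a - b := by
  refine csInf_eq_of_forall_ge_of_forall_gt_exists_lt ?_ ?_ ?_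
  · exact ⟨_, a + 1, by simp, b, ⟨hcb, le_rfl⟩, rfl⟩
  · rintro _ ⟨x, hx, y, hy, rfl⟩
    rw [Real.dist_eq]
    have := le_abs_self (x - y)
    linarith [mem_Ioi.1 hx, hy.2]
  · intro w hw
    -- The midpoint of `a` and `b + w`: its distance to `b` lies strictly between a − b and `w`.
    refine ⟨_, ⟨(w + b + a) / 2, ?_, b, ⟨hcb, le_rfl⟩, rfl⟩, ?_⟩
    · rw [mem_Ioi]; linarith
    · rw [Real.dist_eq, abs_of_pos] <;> linarith

lemma eventually_mul_exp_le {p K c δ : ℝ} (hc : 0 < c) (hδ : 0 < δ) :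
    ∀ᶠ τ : ℝ in atTop, K * τ * Real.exp (-δ * τ) ≤ c * τ ^ (-p) := by
  have h := (tendsto_rpow_mul_exp_neg_mul_atTop_nhds_zero (p + 1) δ hδ).const_mul K
  rw [mul_zero] at h
  filter_upwards [h.eventually (Iio_mem_nhds hc), eventually_gt_atTop 0] with τ h1 h2
  have h3 : 0 < τ ^ (-p) := Real.rpow_pos_of_pos h2 _
  have h4 : τ ^ (p + 1) * τ ^ (-p) = τ := by
    rw [← Real.rpow_add h2]; simp
  have h5 := mul_le_mul_of_nonneg_right (le_of_lt h1) h3.le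
  calc K * τ * Real.exp (-δ * τ) = K * (τ ^ (p + 1) * τ ^ (-p)) * Real.exp (-δ * τ) := by rw [h4]
    _ = K * (τ ^ (p + 1) * Real.exp (-δ * τ)) * τ ^ (-p) := by ring
    _ ≤ _ := h5

/-- After division by 2τ, the constants and the power of τ contribute only O(log τ / τ) to the
logarithm. -/
lemma tendsto_log_div {J : ℝ → ℝ} {c K p d : ℝ} (hc : 0 < c)
    (hl : ∀ᶠ τ in atTop, c * τ ^ (-p) * Real.exp (-(2 * d) * τ) ≤ J τ)
    (hu : ∀ᶠ τ in atTop, J τ ≤ K * Real.exp (-(2 * d) * τ)) :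
    Tendsto (fun τ => 1 / (2 * τ) * Real.log (J τ)) atTop (𝓝 (-d)) := by
  have t0 : Tendsto (fun τ : ℝ => 1 / (2 * τ)) atTop (𝓝 0) := by
    have := (tendsto_inv_atTop_zero (𝕜 := ℝ)).const_mul (1 / 2)
    rw [mul_zero] at this
    refine this.congr fun τ => ?_
    rw [one_div, one_div, mul_inv]
  have t1 : Tendsto (fun τ : ℝ => Real.log τ / τ) atTop (𝓝 0) :=
    Real.isLittleO_log_id_atTop.tendsto_div_nhds_zero
  have hlow : Tendsto (fun τ : ℝ => 1 / (2 * τ) * Real.log c - p / 2 * (Real.log τ / τ) - d) atTop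
      (𝓝 (-d)) := by
    have := ((t0.mul_const (Real.log c)).sub (t1.const_mul (p / 2))).sub_const d
    simpa using this
  have hup : Tendsto (fun τ : ℝ => 1 / (2 * τ) * Real.log K - d) atTop (𝓝 (-d)) := by
    simpa using (t0.mul_const (Real.log K)).sub_const d
  refine tendsto_of_tendsto_of_tendsto_of_le_of_le' hlow hup ?_ ?_
  · filter_upwards [hl, eventually_gt_atTop 0] with τ h1 h2
    have h3 : 0 < τ ^ (-p) := Real.rpow_pos_of_pos h2 _
    have h4 := Real.log_le_log (by positivity) h1
    rw [Real.log_mul (by positivity) (by positivity), Real.log_mul hc.ne' h3.ne', Real.log_exp,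
      Real.log_rpow h2] at h4
    calc _ = 1 / (2 * τ) * (Real.log c + -p * Real.log τ + -(2 * d) * τ) := by field_simp; ring
      _ ≤ _ := mul_le_mul_of_nonneg_left h4 (by positivity)
  · filter_upwards [hl, hu, eventually_gt_atTop 0] with τ h0 h1 h2
    have h3 : 0 < τ ^ (-p) := Real.rpow_pos_of_pos h2 _
    have h5 : 0 < J τ := lt_of_lt_of_le (by positivity) h0
    have hK : 0 < K := pos_of_mul_pos_left (h5.trans_le h1) (Real.exp_pos _).le
    have h4 := Real.log_le_log h5 h1
    rw [Real.log_mul hK.ne' (Real.exp_pos _).ne', Real.log_exp] at h4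
    calc _ ≤ 1 / (2 * τ) * (Real.log K + -(2 * d) * τ) :=
          mul_le_mul_of_nonneg_left h4 (by positivity)
      _ = _ := by field_simp; ring

lemma exists_eventually_le_of_liminf_pos {g : ℝ → ℝ}
    (h : 0 < liminf (fun τ : ℝ => ENNReal.ofReal (g τ)) atTop) :
    ∃ c : ℝ, 0 < c ∧ ∀ᶠ τ in atTop, c ≤ g τ := by
  -- The liminf may be infinite, so a smaller positive value, necessarily finite, is used.
  obtain ⟨e, he0, he⟩ := exists_between h
  have he' : e ≠ ⊤ := (he.trans_le le_top).ne
  refine ⟨e.toReal, ENNReal.toReal_pos he0.ne' he', ?_⟩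
  filter_upwards [eventually_lt_of_lt_liminf he] with τ hτ
  exact ((ENNReal.lt_ofReal_iff_toReal_lt he').1 hτ).le

/-- Sign and decay rate of the data, once the sign of the reflection coefficient is known. -/
theorem sign_and_tendsto_backScatteringData {f : ℝ → ℝ} {a b c T γ β σ κ : ℝ} {u : ℝ → ℝ → ℝ}
    (hf : MemLp f 2 volume) (hsupp : ∀ᵐ x ∂(volume : Measure ℝ), x ∉ Icc c b → f x = 0)
    (ha : 0 ≤ a) (hγ : 0 ≤ γ) (hab : b < a) (hcb : c ≤ b) (hT : 2 * (a - b) < T)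
    (hu : IsWeakSolution a T γ β f u)
    (hord : ∃ μ : ℝ, 0 < liminf (fun τ : ℝ => ENNReal.ofReal
      (τ ^ μ * |∫ y in c..b, Real.exp (-τ * (b - y)) * f y|)) atTop)
    (hσ : |σ| = 1) (hκ : 0 < κ) (hR : ∀ᶠ τ in atTop, κ ≤ σ * (τ - γ * τ - β)) :
    (∃ τ₀ : ℝ, 0 < τ₀ ∧ ∀ τ, τ₀ ≤ τ → 0 < σ * backScatteringData (Icc c b) T f u τ) ∧
    Tendsto (fun τ : ℝ => 1 / (2 * τ) * Real.log |backScatteringData (Icc c b) T f u τ|) atTop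
      (𝓝 (-(a - b))) := by
  -- S > 2(a − b) makes e^{-τS} negligible against the main term; S < T leaves room for the cutoff.
  obtain ⟨S, hdS, hST⟩ := exists_between hT
  obtain ⟨K, hK⟩ := exists_abs_backScatteringData_sub_le hf hsupp ha hγ hab (by linarith) hST hu
  obtain ⟨μ, hμ⟩ := hord
  obtain ⟨l, hl0, hl⟩ := exists_eventually_le_of_liminf_pos hμ
  set F : ℝ → ℝ := fun τ => ∫ y in c..b, Real.exp (-τ * (b - y)) * f y with hF
  set d := a - b with hd
  have hL : ∀ τ, leftPart f τ a ^ 2 = Real.exp (-(2 * d) * τ) * F τ ^ 2 := fun τ => by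
    rw [leftPart_eq_exp_mul hsupp hab hcb, mul_pow, ← Real.exp_nat_mul]
    congr 2
    push_cast; ring
  set N := ∫ y, |f y| with hN
  have hf1 : Integrable f := by
    simpa using integrable_continuous_mul hf hsupp (k := fun _ => 1) continuous_const
  have hFN : ∀ τ, 0 ≤ τ → |F τ| ≤ N := fun τ hτ => by
    have h1 : |F τ| ≤ ∫ y in Ioc c b, |f y| := by
      simp only [hF]
      rw [intervalIntegral.integral_of_le hcb]
      refine norm_integral_le_of_norm_le (f := fun y => Real.exp (-τ * (b - y)) * f y)
        hf1.abs.integrableOn ((ae_restrict_iff' measurableSet_Ioc).2 (ae_of_all _ fun y hy => ?_))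
      rw [norm_mul, Real.norm_eq_abs, abs_of_pos (Real.exp_pos _), Real.norm_eq_abs]
      exact mul_le_of_le_one_left (abs_nonneg _) (Real.exp_le_one_iff.2 (by nlinarith [hy.2]))
    exact h1.trans (setIntegral_le_integral hf1.abs (ae_of_all _ fun y => abs_nonneg _))
  have hN0 : 0 ≤ N := (abs_nonneg _).trans (hFN 0 le_rfl)
  set M : ℝ → ℝ := fun τ => leftPart f τ a ^ 2 / (2 * τ) * reflectionCoeff γ β τ with hM
  have hQ : 0 < 1 + γ + |β| := by positivity
  set k := l ^ 2 * κ / (2 * (1 + γ + |β|)) with hk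
  have hk0 : 0 < k := by positivity
  -- 2μ comes from F², one power from 1/(2τ), and one from the reflection coefficient, which may
  -- decay like 1/τ when γ = 1.
  set p := 2 * μ + 2 with hp
  have hlow : ∀ᶠ τ in atTop, k * τ ^ (-p) * Real.exp (-(2 * d) * τ) ≤ σ * M τ := by
    filter_upwards [hl, hR, eventually_ge_atTop (1 + 2 * |β|)] with τ h1 h2 h3
    have hτ1 : 1 ≤ τ := by linarith [abs_nonneg β]
    have hτ : 0 < τ := by linarith
    have hden := reflectionCoeff_denom_pos hγ h3
    have hden2 : τ + γ * τ + β ≤ (1 + γ + |β|) * τ := by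
      have := mul_le_mul_of_nonneg_left hτ1 (abs_nonneg β)
      linarith [le_abs_self β]
    have r1 : κ / ((1 + γ + |β|) * τ) ≤ σ * reflectionCoeff γ β τ := by
      rw [reflectionCoeff, mul_div_assoc']
      exact div_le_div₀ (hκ.le.trans h2) h2 hden hden2
    have hμ0 : 0 < τ ^ μ := Real.rpow_pos_of_pos hτ _
    have r2 : l ^ 2 * τ ^ (-(2 * μ)) ≤ F τ ^ 2 := by
      have h4 : l ^ 2 ≤ (τ ^ μ * |F τ|) ^ 2 := pow_le_pow_left₀ hl0.le h1 2
      have e : τ ^ (-(2 * μ)) = ((τ ^ μ) ^ 2)⁻¹ := by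
        rw [Real.rpow_neg hτ.le, mul_comm, Real.rpow_mul hτ.le, Real.rpow_two]
      rw [e, ← div_eq_mul_inv, div_le_iff₀ (by positivity)]
      rw [mul_pow, sq_abs] at h4
      linarith
    have e2 : τ ^ (-p) = τ ^ (-(2 * μ)) / τ ^ 2 := by
      rw [hp, neg_add, Real.rpow_add hτ, Real.rpow_neg hτ.le 2, Real.rpow_two]
      rfl
    calc k * τ ^ (-p) * Real.exp (-(2 * d) * τ) =
        Real.exp (-(2 * d) * τ) * (l ^ 2 * τ ^ (-(2 * μ))) / (2 * τ) *
          (κ / ((1 + γ + |β|) * τ)) := by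
          rw [e2, hk]; field_simp
      _ ≤ Real.exp (-(2 * d) * τ) * F τ ^ 2 / (2 * τ) * (σ * reflectionCoeff γ β τ) := by
          gcongr
      _ = σ * M τ := by rw [hM]; simp only [hL]; ring
  have hup : ∀ᶠ τ in atTop, σ * M τ ≤ (3 * N ^ 2) * Real.exp (-(2 * d) * τ) := by
    filter_upwards [eventually_ge_atTop (1 + 2 * |β|)] with τ h3
    have hτ1 : 1 ≤ τ := by linarith [abs_nonneg β]
    have hτ : 0 < τ := by linarith
    have r1 : σ * reflectionCoeff γ β τ ≤ 3 := by
      refine (le_abs_self _).trans ?_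
      rw [abs_mul, hσ, one_mul]
      exact abs_reflectionCoeff_le hγ h3
    have r2 : F τ ^ 2 ≤ N ^ 2 := by
      rw [← sq_abs]; exact pow_le_pow_left₀ (abs_nonneg _) (hFN τ hτ.le) 2
    calc σ * M τ = Real.exp (-(2 * d) * τ) * F τ ^ 2 / (2 * τ) * (σ * reflectionCoeff γ β τ) := by
          rw [hM]; simp only [hL]; ring
      _ ≤ Real.exp (-(2 * d) * τ) * F τ ^ 2 / (2 * τ) * 3 := by gcongr
      _ ≤ Real.exp (-(2 * d) * τ) * F τ ^ 2 / 1 * 3 := by gcongr; linarith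
      _ ≤ Real.exp (-(2 * d) * τ) * N ^ 2 / 1 * 3 := by gcongr
      _ = _ := by ring
  have herr : ∀ c' q : ℝ, 0 < c' → ∀ᶠ τ in atTop,
      |σ * backScatteringData (Icc c b) T f u τ - σ * M τ| ≤
        c' * τ ^ (-q) * Real.exp (-(2 * d) * τ) := fun c' q hc' => by
    filter_upwards [eventually_ge_atTop (1 + 2 * |β|),
      eventually_mul_exp_le (p := q) (K := K) (δ := S - 2 * d) hc' (by linarith)] with τ h1 h2
    rw [← mul_sub, abs_mul, hσ, one_mul]
    refine (hK τ h1).trans ?_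
    have e : Real.exp (-τ * S) = Real.exp (-(S - 2 * d) * τ) * Real.exp (-(2 * d) * τ) := by
      rw [← Real.exp_add]; ring_nf
    rw [e, ← mul_assoc]
    exact mul_le_mul_of_nonneg_right h2 (Real.exp_pos _).le
  have hlow' : ∀ᶠ τ in atTop, k / 2 * τ ^ (-p) * Real.exp (-(2 * d) * τ) ≤
      σ * backScatteringData (Icc c b) T f u τ := by
    filter_upwards [hlow, herr (k / 2) p (by positivity)] with τ h1 h2
    have := (abs_le.1 h2).1
    linarith
  have hup' : ∀ᶠ τ in atTop, σ * backScatteringData (Icc c b) T f u τ ≤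
      (3 * N ^ 2 + 1) * Real.exp (-(2 * d) * τ) := by
    filter_upwards [hup, herr 1 0 one_pos] with τ h1 h2
    have := (abs_le.1 h2).2
    rw [neg_zero, Real.rpow_zero] at this
    linarith
  have hpos : ∀ᶠ τ in atTop, 0 < σ * backScatteringData (Icc c b) T f u τ := by
    filter_upwards [hlow', eventually_gt_atTop 0] with τ h1 h2
    have := Real.rpow_pos_of_pos h2 (-p)
    exact lt_of_lt_of_le (by positivity) h1
  refine ⟨?_, (tendsto_log_div (by positivity) hlow' hup').congr' ?_⟩
  · obtain ⟨τ₁, h1⟩ := eventually_atTop.1 hpos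
    exact ⟨max τ₁ 1, by positivity, fun τ hτ => h1 τ ((le_max_left _ _).trans hτ)⟩
  · filter_upwards [hpos] with τ h1
    rw [← abs_of_pos h1, abs_mul, hσ, one_mul]

end BackScattering

/-! ### The theorem: cases according to γ and β -/

theorem theorem4p2
    (a T γ β b ε : ℝ) (ha : 0 < a) (hγ : 0 ≤ γ) (hb : b < 0) (hε : 0 < ε)
    (D B : Set ℝ) (hD : D = Set.Ioi a) (hB : B = Set.Icc (b - ε) b)
    (f : ℝ → ℝ) (hf : MeasureTheory.MemLp f 2 MeasureTheory.volume)
    -- the support of `f` is contained in `B`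
    (hsupp : ∀ᵐ x ∂(MeasureTheory.volume : MeasureTheory.Measure ℝ), x ∉ B → f x = 0)
    -- `b` is not a zero of infinite order of `f`
    (hord : ∃ μ : ℝ, 0 < Filter.liminf (fun τ : ℝ => ENNReal.ofReal
      (τ ^ μ * |∫ y in (b - ε)..b, Real.exp (-τ * (b - y)) * f y|)) Filter.atTop)
    (hT : 2 * BackScattering.setDist D B < T)
    (u : ℝ → ℝ → ℝ) (hu : BackScattering.IsWeakSolution a T γ β f u) :
    (γ ≠ 1 →
      (γ < 1 → ∃ τ₀ : ℝ, 0 < τ₀ ∧ ∀ τ : ℝ, τ₀ ≤ τ →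
        0 < BackScattering.backScatteringData B T f u τ) ∧
      (1 < γ → ∃ τ₀ : ℝ, 0 < τ₀ ∧ ∀ τ : ℝ, τ₀ ≤ τ →
        BackScattering.backScatteringData B T f u τ < 0) ∧
      Filter.Tendsto
        (fun τ : ℝ => 1 / (2 * τ) * Real.log |BackScattering.backScatteringData B T f u τ|)
        Filter.atTop (nhds (-BackScattering.setDist D B))) ∧
    (γ = 1 → β ≠ 0 →
      (β < 0 → ∃ τ₀ : ℝ, 0 < τ₀ ∧ ∀ τ : ℝ, τ₀ ≤ τ →
        0 < BackScattering.backScatteringData B T f u τ) ∧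
      (0 < β → ∃ τ₀ : ℝ, 0 < τ₀ ∧ ∀ τ : ℝ, τ₀ ≤ τ →
        BackScattering.backScatteringData B T f u τ < 0) ∧
      Filter.Tendsto
        (fun τ : ℝ => 1 / (2 * τ) * Real.log |BackScattering.backScatteringData B T f u τ|)
        Filter.atTop (nhds (-BackScattering.setDist D B))) := by
  subst hD hB
  have hab : b < a := hb.trans ha
  have hcb : b - ε ≤ b := by linarith
  rw [BackScattering.setDist_Ioi_Icc hab hcb] at *
  have main := fun σ κ => BackScattering.sign_and_tendsto_backScatteringData (σ := σ) (κ := κ)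
    hf hsupp ha.le hγ hab hcb hT hu hord
  have hlin : ∀ k : ℝ, 0 < k → ∀ l : ℝ, ∀ᶠ τ : ℝ in Filter.atTop, 1 ≤ k * τ - l := fun k hk l => by
    filter_upwards [Filter.eventually_ge_atTop ((1 + l) / k)] with τ hτ
    rw [div_le_iff₀ hk] at hτ
    linarith
  -- The numerator (1 − γ)τ − β is the constant −β if γ = 1, which is then its own lower bound; if γ
  -- < 1 it tends to infinity and eventually exceeds 1.
  have hpos : γ < 1 ∨ (γ = 1 ∧ β < 0) → _ := fun h => main 1 (if γ = 1 then -β else 1) (by simp)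
    (by split_ifs with h1
        · rcases h with h | h
          · exact absurd h1 h.ne
          · linarith [h.2]
        · exact one_pos)
    (by split_ifs with h1
        · exact Filter.Eventually.of_forall fun τ => by rw [h1]; linarith
        · rcases h with h | h
          · filter_upwards [hlin (1 - γ) (by linarith) β] with τ hτ
            linarith
          · exact absurd h.1 h1)
  have hneg : 1 < γ ∨ (γ = 1 ∧ 0 < β) → _ := fun h => main (-1) (if γ = 1 then β else 1) (by simp)
    (by split_ifs with h1
        · rcases h with h | h
          · exact absurd h1 h.ne'
          · exact h.2
        · exact one_pos)
    (by split_ifs with h1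
        · exact Filter.Eventually.of_forall fun τ => by rw [h1]; linarith
        · rcases h with h | h
          · filter_upwards [hlin (γ - 1) (by linarith) (-β)] with τ hτ
            linarith
          · exact absurd h.1 h1)
  simp only [one_mul, neg_mul, Left.neg_pos_iff] at hpos hneg
  refine ⟨fun h => ⟨fun h1 => (hpos (Or.inl h1)).1, fun h1 => (hneg (Or.inl h1)).1, ?_⟩,
    fun h h' => ⟨fun h1 => (hpos (Or.inr ⟨h, h1⟩)).1, fun h1 => (hneg (Or.inr ⟨h, h1⟩)).1, ?_⟩⟩
  · rcases lt_or_gt_of_ne h with h1 | h1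
    · exact (hpos (Or.inl h1)).2
    · exact (hneg (Or.inl h1)).2
  · rcases lt_or_gt_of_ne h' with h1 | h1
    · exact (hpos (Or.inr ⟨h, h1⟩)).2
    · exact (hneg (Or.inr ⟨h, h1⟩)).2
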